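/- Let $K$ be a field and $A=K[X_1,X_2,X_3,X_4]$. Let $\alpha_1,\alpha_2,\alpha_3,\alpha_4>1$ and $\alpha_{21}$ be integers with $0<\alpha_{21}<\alpha_1-1$, and put $$\begin{aligned} n_1&=\alpha_2\alpha_3(\alpha_4-1)+1,\\ n_2&=\alpha_{21}\alpha_3\alpha_4+(\alpha_1-\alpha_{21}-1)(\alpha_3-1)+\alpha_3,\\ n_3&=\alpha_1\alpha_4+(\alpha_1-\alpha_{21}-1)(\alpha_2-1)(\alpha_4-1)-\alpha_4+1,\\ n_4&=\alpha_1\alpha_2(\alpha_3-1)+\alpha_{21}(\alpha_2-1)+\alpha_2 .\end{aligned}$$ Assume that $\gcd(n_1,n_2,n_3,n_4)=1$, that $S=\langle n_1,n_2,n_3,n_4\rangle$ is a pseudo-symmetric numerical semigroup (that is, its Frobenius number $F$ is even and $F-x\in S$ for every integer $x\notin S$ with $x\neq F/2$), that $n_1<n_2<n_3<n_4$, and that $\alpha_2>\alpha_{21}+1$. Let $I_S$ be the kernel of $A\to K[t]$, $X_i\mapsto t^{n_i}$. For $f\in A$ let $f_*$ be the homogeneous summand of $f$ of least degree (its initial form),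 and let $I_{S*}=\langle f_*\mid f\in I_S\rangle$, so that $A/I_{S*}$ is the coordinate ring of the tangent cone at the origin of the monomial curve of $S$. For $0\le j\le\alpha_4-1$ let $s_j$ be the smallest integer $s\ge 0$ with $$((\alpha_4-1)s+j)\alpha_2+\alpha_4-j< s\alpha_1+((\alpha_4-1)s+j+1)\alpha_{21}+\alpha_3-s,$$ and let $s_{-1}=0$. Let $f_2=X_2^{\alpha_2}-X_1^{\alpha_{21}}X_4$, $f_3=X_3^{\alpha_3}-X_1^{\alpha_1-\alpha_{21}-1}X_2$, $f_4=X_4^{\alpha_4}-X_1X_2^{\alpha_2-1}X_3^{\alpha_3-1}$ and $$f_{1,j}=X_1^{\alpha_1+j\alpha_{21}}-X_2^{j\alpha_2}X_3X_4^{\alpha_4-(j+1)},$$ $$g_{j,i}=X_2^{((\alpha_4-1)i+j)\alpha_2+1}X_4^{\alpha_4-(j+1)}-X_1^{i\alpha_1+((\alpha_4-1)i+j+1)\alpha_{21}+1}X_3^{\alpha_3-(i+1)}$$ for $0\le j\le\alpha_4-1$ and $s_{j-1}\le i\le s_j$. Then: 1. The initial forms are $$f_{1,j*}=-X_2^{j\alpha_2}X_3X_4^{\alpha_4-(j+1)},\quad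 f_{2*}=-X_1^{\alpha_{21}}X_4,\quad f_{3*}=X_3^{\alpha_3},\quad f_{4*}=X_4^{\alpha_4},\quad g_{j,s_j*}=X_2^{((\alpha_4-1)s_j+j)\alpha_2+1}X_4^{\alpha_4-(j+1)},$$ and, for $s_{j-1}\le i<s_j$, $g_{j,i*}=-X_1^{i\alpha_1+((\alpha_4-1)i+j+1)\alpha_{21}+1}X_3^{\alpha_3-(i+1)}$ if the two monomials of $g_{j,i}$ have different total degrees, and $g_{j,i*}=g_{j,i}$ if they have the same total degree. 2. The set $\{f_{1,j*},f_{2*},f_{3*},f_{4*},g_{j,i*}\mid 0\le j\le\alpha_4-1,\ s_{j-1}\le i\le s_j\}$ generates $I_{S*}$ and is a standard basis of $I_{S*}$ with respect to the negative degree reverse lexicographic ordering with $X_1>X_2>X_3>X_4$ (that is, its leading monomials generate the ideal of all leading monomials of $I_{S*}$). 3. $X_1$ divides $f_{2*}$, and the tangent cone $A/I_{S*}$ is not Cohen–Macaulay. -/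

import Mathlib

open MvPolynomial

noncomputable section

namespace PseudoSym

/-! ### Numerical semigroups -/

/-- A submonoid `S` of `ℕ` is a pseudo-symmetric numerical semigroup: its complement has a largest
element `F` (the Frobenius number), `F` is even, and `F - x ∈ S` for every gap `x ≠ F / 2`.
(For a negative integer `x` the element `F - x > F` is automatically in `S`.) -/
def IsPseudoSymmetric (S : AddSubmonoid ℕ) : Prop :=
  ∃ F : ℕ, Even F ∧ F ∉ S ∧ (∀ x, F < x → x ∈ S) ∧
    ∀ x, x ∉ S → 2 * x ≠ F → F - x ∈ S

/-- The defining ideal of the monomial curve `X i = t ^ n i`: the kernel of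
`K[X₁, …, X_k] → K[t]`, `X i ↦ t ^ n i` (whose image is the semigroup ring). -/
def definingIdeal (K : Type*) [Field K] {k : ℕ} (n : Fin k → ℕ) :
    Ideal (MvPolynomial (Fin k) K) :=
  RingHom.ker (aeval (fun i => (Polynomial.X : Polynomial K) ^ n i) :
    MvPolynomial (Fin k) K →ₐ[K] Polynomial K)

/-! ### Initial forms and standard bases -/

section InitialForms

variable {K : Type*} [Field K] {k : ℕ}

/-- The least total degree of a monomial occurring in `f` (and `0` for `f = 0`). -/
def order (f : MvPolynomial (Fin k) K) : ℕ :=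
  sInf {d | ∃ a ∈ f.support, Finsupp.degree a = d}

/-- The initial form `f_*`: the homogeneous summand of `f` of least degree (`0` for `f = 0`). -/
def initialForm (f : MvPolynomial (Fin k) K) : MvPolynomial (Fin k) K :=
  homogeneousComponent (order f) f

/-- The ideal of initial forms `I_* = ⟨f_* | f ∈ I⟩`. -/
def initialIdeal (I : Ideal (MvPolynomial (Fin k) K)) : Ideal (MvPolynomial (Fin k) K) :=
  Ideal.span {h | ∃ f ∈ I, h = initialForm f}

/-- `X ^ a < X ^ b` in the negative degree reverse lexicographic (local) monomial ordering with
`X₁ > X₂ > ⋯ > X_k`: either `X ^ a` has the larger total degree, or the degrees agree and `a` has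
the larger exponent at the last variable at which `a` and `b` differ. -/
def dsLT (a b : Fin k →₀ ℕ) : Prop :=
  Finsupp.degree b < Finsupp.degree a ∨
    (Finsupp.degree a = Finsupp.degree b ∧ ∃ i, (∀ l, i < l → a l = b l) ∧ b i < a i)

/-- `X ^ a` is the leading monomial of `f` for the ordering `dsLT`. -/
def IsLeadingExponent (f : MvPolynomial (Fin k) K) (a : Fin k →₀ ℕ) : Prop :=
  a ∈ f.support ∧ ∀ b ∈ f.support, b ≠ a → dsLT b a

/-- The monomial ideal generated by the leading monomials of the (nonzero) elements of a set. -/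
def leadingIdeal (G : Set (MvPolynomial (Fin k) K)) : Ideal (MvPolynomial (Fin k) K) :=
  Ideal.span {m | ∃ f ∈ G, ∃ a, IsLeadingExponent f a ∧ m = monomial a (1 : K)}

/-- `G` is a standard basis of `I` (with respect to the ordering `dsLT`): a finite subset of `I`
whose leading monomials generate the leading ideal of `I`. -/
def IsStandardBasis (G : Set (MvPolynomial (Fin k) K)) (I : Ideal (MvPolynomial (Fin k) K)) :
    Prop :=
  G.Finite ∧ G ⊆ (I : Set (MvPolynomial (Fin k) K)) ∧
    leadingIdeal G = leadingIdeal (I : Set (MvPolynomial (Fin k) K))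

end InitialForms

/-! ### Cohen–Macaulay rings -/

/-- A (Noetherian) local ring is Cohen–Macaulay if its maximal ideal contains a regular sequence
whose length is the Krull dimension of the ring. -/
def IsCohenMacaulayLocalRing (R : Type*) [CommRing R] [IsLocalRing R] : Prop :=
  ∃ rs : List R, (∀ r ∈ rs, r ∈ IsLocalRing.maximalIdeal R) ∧
    RingTheory.Sequence.IsRegular R rs ∧ ((rs.length : ℕ∞) : WithBot ℕ∞) = ringKrullDim R

/-- A (Noetherian) ring is Cohen–Macaulay if all its localizations at primes are. -/
def IsCohenMacaulayRing (R : Type*) [CommRing R] : Prop :=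
  ∀ (P : Ideal R) [P.IsPrime], IsCohenMacaulayLocalRing (Localization.AtPrime P)

/-! ### Komeda's parametrization -/

/-- The integers `α₁, α₂, α₃, α₄, α₂₁`. -/
structure Params where
  α₁ : ℕ
  α₂ : ℕ
  α₃ : ℕ
  α₄ : ℕ
  α₂₁ : ℕ

namespace Params

variable (p : Params)

/-- The admissibility conditions `αᵢ > 1` and `0 < α₂₁ < α₁ - 1`. -/
def Admissible : Prop :=
  1 < p.α₁ ∧ 1 < p.α₂ ∧ 1 < p.α₃ ∧ 1 < p.α₄ ∧ 0 < p.α₂₁ ∧ p.α₂₁ < p.α₁ - 1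

/-- The generators `n₁, n₂, n₃, n₄` (no subtraction truncates for admissible parameters). -/
def gen : Fin 4 → ℕ :=
  ![p.α₂ * p.α₃ * (p.α₄ - 1) + 1,
    p.α₂₁ * p.α₃ * p.α₄ + (p.α₁ - p.α₂₁ - 1) * (p.α₃ - 1) + p.α₃,
    p.α₁ * p.α₄ + (p.α₁ - p.α₂₁ - 1) * (p.α₂ - 1) * (p.α₄ - 1) - p.α₄ + 1,
    p.α₁ * p.α₂ * (p.α₃ - 1) + p.α₂₁ * (p.α₂ - 1) + p.α₂]

/-- `((α₄ - 1) i + j) α₂ + α₄ - j`, the degree of the first monomial of `g_{j,i}`. -/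
def degLeft (j i : ℕ) : ℤ :=
  (((p.α₄ : ℤ) - 1) * i + j) * p.α₂ + p.α₄ - j

/-- `i α₁ + ((α₄ - 1) i + j + 1) α₂₁ + α₃ - i`, the degree of the second monomial of `g_{j,i}`. -/
def degRight (j i : ℕ) : ℤ :=
  (i : ℤ) * p.α₁ + (((p.α₄ : ℤ) - 1) * i + j + 1) * p.α₂₁ + p.α₃ - i

/-- `s_j`: the smallest `s` with
`((α₄ - 1) s + j) α₂ + α₄ - j < s α₁ + ((α₄ - 1) s + j + 1) α₂₁ + α₃ - s`. -/
def s (j : ℕ) : ℕ := sInf {i : ℕ | p.degLeft j i < p.degRight j i}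

/-- `s_{j-1}`, with the convention `s_{-1} = 0`. -/
def sPrev : ℕ → ℕ
  | 0 => 0
  | j + 1 => p.s j

variable (K : Type*) [Field K]

/-- `f_{1,j} = X₁ ^ (α₁ + j α₂₁) - X₂ ^ (j α₂) X₃ X₄ ^ (α₄ - (j + 1))`. -/
def f₁ (j : ℕ) : MvPolynomial (Fin 4) K :=
  X 0 ^ (p.α₁ + j * p.α₂₁) - X 1 ^ (j * p.α₂) * X 2 * X 3 ^ (p.α₄ - (j + 1))

/-- `f₂ = X₂ ^ α₂ - X₁ ^ α₂₁ X₄`. -/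
def f₂ : MvPolynomial (Fin 4) K :=
  X 1 ^ p.α₂ - X 0 ^ p.α₂₁ * X 3

/-- `f₃ = X₃ ^ α₃ - X₁ ^ (α₁ - α₂₁ - 1) X₂`. -/
def f₃ : MvPolynomial (Fin 4) K :=
  X 2 ^ p.α₃ - X 0 ^ (p.α₁ - p.α₂₁ - 1) * X 1

/-- `f₄ = X₄ ^ α₄ - X₁ X₂ ^ (α₂ - 1) X₃ ^ (α₃ - 1)`. -/
def f₄ : MvPolynomial (Fin 4) K :=
  X 3 ^ p.α₄ - X 0 * X 1 ^ (p.α₂ - 1) * X 2 ^ (p.α₃ - 1)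

/-- The first monomial `X₂ ^ (((α₄ - 1) i + j) α₂ + 1) X₄ ^ (α₄ - (j + 1))` of `g_{j,i}`. -/
def gLeft (j i : ℕ) : MvPolynomial (Fin 4) K :=
  X 1 ^ (((p.α₄ - 1) * i + j) * p.α₂ + 1) * X 3 ^ (p.α₄ - (j + 1))

/-- The second monomial
`X₁ ^ (i α₁ + ((α₄ - 1) i + j + 1) α₂₁ + 1) X₃ ^ (α₃ - (i + 1))` of `g_{j,i}`. -/
def gRight (j i : ℕ) : MvPolynomial (Fin 4) K :=
  X 0 ^ (i * p.α₁ + ((p.α₄ - 1) * i + j + 1) * p.α₂₁ + 1) * X 2 ^ (p.α₃ - (i + 1))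

/-- The binomial `g_{j,i}`. -/
def g (j i : ℕ) : MvPolynomial (Fin 4) K :=
  p.gLeft K j i - p.gRight K j i

/-- The set `G = {f_{1,j}, f₂, f₃, f₄, g_{j,i_j}}`, where `0 ≤ j ≤ α₄ - 1` and
`s_{j-1} ≤ i_j ≤ s_j`. -/
def G : Set (MvPolynomial (Fin 4) K) :=
  {h | ∃ j < p.α₄, h = p.f₁ K j} ∪ {p.f₂ K, p.f₃ K, p.f₄ K} ∪
    {h | ∃ j < p.α₄, ∃ i, p.sPrev j ≤ i ∧ i ≤ p.s j ∧ h = p.g K j i}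

end Params

end PseudoSym

end

noncomputable section

namespace PseudoSym

/-! ### The monomial ordering -/

section Order

variable {k : ℕ}

/-! Every element of `G` is, up to sign, a binomial whose two monomials have the same weight
(exponent of t). Orient it as a rewriting rule from the leading monomial to the other one. The
theorem rests on one fact, `eq_of_isNormal`: two monomials of equal weight that are divisible by no
leading monomial are equal. Since rewriting descends in the ordering, the unique normal monomial of
a given weight is the least of that weight, hence has the largest degree.

Modulo the initial forms of `G`, a monomial is therefore its normal form if the degrees agree, and
zero otherwise. Conversely, an element of the ideal of initial forms has vanishing coefficient sum
at (weight, maximal degree of that weight); these functionals define `gradedKernel`. The two facts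
together give generation (`span_initialForm_eq`) and the standard basis property
(`isStandardBasis_initialForm`).

For uniqueness, the set `reduced` has exactly n₁ elements and meets all residues mod n₁, so a weight
determines the power of X₁ and the reduced monomial representing it (`reduced_unique`). Replacing
X₂^α₂ by X₁^α₂₁ X₄ already takes a normal monomial to such a representative, except in the "long"
case, where X₂ X₄^(α₄-1) and then X₃ X₄^(α₄-1) must also be replaced. The original monomial can be
read back in both cases, and the g_{j,i} are what keeps them from colliding (`short_ne_long`).

The tangent cone is not Cohen–Macaulay because X₄ is nonzero at the origin yet killed by powers of
all variables, so the depth there is zero, while the X₁-axis lies in the cone and makes the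
dimension positive. -/

theorem dsLT_irrefl (a : Fin k →₀ ℕ) : ¬ dsLT a a := by
  rintro (h | ⟨-, i, -, h⟩) <;> exact lt_irrefl _ h

theorem dsLT_trans {a b c : Fin k →₀ ℕ} (hab : dsLT a b) (hbc : dsLT b c) : dsLT a c := by
  rcases hab with h | ⟨h, i, hi, hi'⟩ <;> rcases hbc with h' | ⟨h', j, hj, hj'⟩
  · exact Or.inl (h'.trans h)
  · exact Or.inl (h' ▸ h)
  · exact Or.inl (h ▸ h')
  · refine Or.inr ⟨h.trans h', ?_⟩
    rcases lt_trichotomy i j with hij | rfl | hij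
    · exact ⟨j, fun l hl => (hi l (hij.trans hl)).trans (hj l hl), by rw [hi j hij]; exact hj'⟩
    · exact ⟨i, fun l hl => (hi l hl).trans (hj l hl), hj'.trans hi'⟩
    · exact ⟨i, fun l hl => (hi l hl).trans (hj l (hij.trans hl)), by rw [← hj i hij]; exact hi'⟩

theorem dsLT_asymm {a b : Fin k →₀ ℕ} (hab : dsLT a b) : ¬ dsLT b a :=
  fun hba => dsLT_irrefl a (dsLT_trans hab hba)

theorem dsLT_add_right {a b : Fin k →₀ ℕ} (hab : dsLT a b) (c : Fin k →₀ ℕ) :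
    dsLT (a + c) (b + c) := by
  rcases hab with h | ⟨h, i, hi, hi'⟩
  · exact Or.inl (by simpa using h)
  · exact Or.inr ⟨by simpa using h, i, fun l hl => by simp [hi l hl], by simpa using hi'⟩

theorem degree_le_of_dsLT {a b : Fin k →₀ ℕ} (hab : dsLT a b) :
    Finsupp.degree b ≤ Finsupp.degree a := by
  rcases hab with h | ⟨h, -⟩
  · exact h.le
  · exact h.ge

/-- Induction along the ordering inside the (finite) sets of exponents of given weight. -/
theorem dsLT_induction {n : Fin k → ℕ} (hn : ∀ i, n i ≠ 0) {P : (Fin k →₀ ℕ) → Prop}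
    (h : ∀ a, (∀ b, Finsupp.weight n b = Finsupp.weight n a → dsLT b a → P b) → P a)
    (a : Fin k →₀ ℕ) : P a := by
  have hst : IsStrictOrder (Fin k →₀ ℕ) dsLT :=
    { irrefl := dsLT_irrefl, trans := fun _ _ _ => dsLT_trans }
  -- The ordering itself is not well-founded, since descending may raise the degree forever;
  -- positive weights leave only finitely many exponents of each weight.
  have hwf := (Finsupp.finite_of_nat_weight_eq n hn (Finsupp.weight n a)).wellFoundedOn (r := dsLT)
  exact hwf.induction (P := P) (x := a) rfl fun b hb ih =>
    h b fun c hc hcb => ih c (hc.trans hb) hcb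

end Order

/-! ### Initial forms of binomials -/

section Binomial

variable {K : Type*} [Field K] {k : ℕ}

theorem initialForm_neg (f : MvPolynomial (Fin k) K) : initialForm (-f) = -initialForm f := by
  have : order (-f) = order f := by simp [order, support_neg]
  rw [initialForm, this, map_neg, initialForm]

theorem support_binomial {u v : Fin k →₀ ℕ} (h : u ≠ v) :
    (monomial u (1 : K) - monomial v 1).support = {u, v} := by
  ext a
  simp only [mem_support_iff, coeff_sub, coeff_monomial, Finset.mem_insert, Finset.mem_singleton]
  by_cases hu : u = a <;> by_cases hv : v = a <;> simp_all [eq_comm]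

theorem ne_of_dsLT {a b : Fin k →₀ ℕ} (hab : dsLT a b) : a ≠ b := by
  rintro rfl; exact dsLT_irrefl _ hab

theorem order_binomial {u v : Fin k →₀ ℕ} (h : dsLT v u) :
    order (monomial u (1 : K) - monomial v 1) = Finsupp.degree u := by
  rw [order, support_binomial (ne_of_dsLT h).symm]
  refine IsLeast.csInf_eq ⟨⟨u, by simp, rfl⟩, ?_⟩
  rintro d ⟨a, ha, rfl⟩
  rcases Finset.mem_insert.1 ha with rfl | ha
  · exact le_rfl
  · rw [Finset.mem_singleton.1 ha]; exact degree_le_of_dsLT h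

theorem homogeneousComponent_monomial (d : ℕ) (u : Fin k →₀ ℕ) (r : K) :
    homogeneousComponent d (monomial u r) = if d = Finsupp.degree u then monomial u r else 0 :=
  homogeneousComponent_of_mem (isHomogeneous_monomial r rfl)

theorem initialForm_binomial_of_lt {u v : Fin k →₀ ℕ}
    (h : Finsupp.degree u < Finsupp.degree v) :
    initialForm (monomial u (1 : K) - monomial v 1) = monomial u 1 := by
  rw [initialForm, order_binomial (Or.inl h), map_sub, homogeneousComponent_monomial,
    homogeneousComponent_monomial, if_pos rfl, if_neg h.ne, sub_zero]

theorem initialForm_binomial_of_eq {u v : Fin k →₀ ℕ} (h : dsLT v u)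
    (h' : Finsupp.degree u = Finsupp.degree v) :
    initialForm (monomial u (1 : K) - monomial v 1) = monomial u 1 - monomial v 1 := by
  rw [initialForm, order_binomial h, map_sub, homogeneousComponent_monomial,
    homogeneousComponent_monomial, if_pos rfl, if_pos h']

theorem isLeadingExponent_neg {f : MvPolynomial (Fin k) K} {a : Fin k →₀ ℕ} :
    IsLeadingExponent (-f) a ↔ IsLeadingExponent f a := by
  simp [IsLeadingExponent, support_neg]

theorem isLeadingExponent_initialForm_binomial {u v : Fin k →₀ ℕ} (h : dsLT v u) :
    IsLeadingExponent (initialForm (monomial u (1 : K) - monomial v 1)) u := by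
  by_cases h' : Finsupp.degree u = Finsupp.degree v
  · rw [initialForm_binomial_of_eq h h', IsLeadingExponent, support_binomial (ne_of_dsLT h).symm]
    refine ⟨by simp, fun b hb hbu => ?_⟩
    rcases Finset.mem_insert.1 hb with rfl | hb
    · exact (hbu rfl).elim
    · rw [Finset.mem_singleton.1 hb]; exact h
  · rw [initialForm_binomial_of_lt (lt_of_le_of_ne (degree_le_of_dsLT h) h')]
    refine ⟨by simp, fun b hb hbu => ?_⟩
    exact (hbu (Finset.mem_singleton.1 (support_monomial_subset hb))).elim

end Binomial

/-! ### The functionals separating the initial ideal -/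

section Functional

variable {K : Type*} [Field K] {k : ℕ} (n : Fin k → ℕ)

theorem aeval_monomial_eq (a : Fin k →₀ ℕ) (r : K) :
    aeval (fun i => (Polynomial.X : Polynomial K) ^ n i) (monomial a r) =
      Polynomial.monomial (Finsupp.weight n a) r := by
  rw [aeval_monomial, Finsupp.weight_eq_sum, Finsupp.prod_fintype _ _ (fun i => pow_zero _)]
  simp_rw [← pow_mul, Finset.prod_pow_eq_pow_sum, smul_eq_mul, mul_comm]
  rw [← Polynomial.C_mul_X_pow_eq_monomial, Polynomial.algebraMap_eq]

theorem monomial_sub_mem_definingIdeal {u v : Fin k →₀ ℕ}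
    (h : Finsupp.weight n u = Finsupp.weight n v) :
    monomial u (1 : K) - monomial v 1 ∈ definingIdeal K n := by
  rw [definingIdeal, RingHom.mem_ker, map_sub]
  have h1 := aeval_monomial_eq (K := K) n u 1
  have h2 := aeval_monomial_eq (K := K) n v 1
  rw [sub_eq_zero]
  exact h1.trans (by rw [h, ← h2])

theorem coeff_aeval (f : MvPolynomial (Fin k) K) (s : ℕ) :
    (aeval (fun i => (Polynomial.X : Polynomial K) ^ n i) f).coeff s =
      ∑ b ∈ f.support, if Finsupp.weight n b = s then coeff b f else 0 := by
  conv_lhs => rw [f.as_sum, map_sum, Polynomial.finsetSum_coeff]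
  refine Finset.sum_congr rfl fun b _ => ?_
  rw [aeval_monomial_eq, Polynomial.coeff_monomial]

/-- The sum of the coefficients of `f` at the monomials of weight `s` and degree `d`. -/
def coeffSum (s d : ℕ) : MvPolynomial (Fin k) K →ₗ[K] K :=
  (basisMonomials (Fin k) K).constr K fun b =>
    if Finsupp.weight n b = s ∧ Finsupp.degree b = d then 1 else 0

theorem coeffSum_monomial (s d : ℕ) (b : Fin k →₀ ℕ) (r : K) :
    coeffSum n s d (monomial b r) =
      if Finsupp.weight n b = s ∧ Finsupp.degree b = d then r else 0 := by
  have h : monomial b r = r • basisMonomials (Fin k) K b := by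
    simp [smul_monomial]
  rw [h, map_smul, coeffSum, Module.Basis.constr_basis]
  simp

theorem coeffSum_eq_sum (s d : ℕ) (f : MvPolynomial (Fin k) K) :
    coeffSum n s d f = ∑ b ∈ f.support,
      if Finsupp.weight n b = s ∧ Finsupp.degree b = d then coeff b f else 0 := by
  conv_lhs => rw [f.as_sum, map_sum]
  exact Finset.sum_congr rfl fun b _ => coeffSum_monomial n s d b _

theorem coeffSum_monomial_mul (s d : ℕ) (c : Fin k →₀ ℕ) (r : K) (f : MvPolynomial (Fin k) K) :
    coeffSum n s d (monomial c r * f) =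
      if Finsupp.weight n c ≤ s ∧ Finsupp.degree c ≤ d then
        r * coeffSum n (s - Finsupp.weight n c) (d - Finsupp.degree c) f else 0 := by
  induction f using MvPolynomial.induction_on' with
  | monomial u t =>
    rw [monomial_mul, coeffSum_monomial, coeffSum_monomial]
    simp only [map_add]
    split_ifs <;> first | rfl | (simp; done) | omega
  | add p q hp hq =>
    rw [mul_add, map_add, hp, hq, map_add]
    split_ifs <;> ring

/-- The polynomials all of whose coefficient sums at (a weight, the largest degree of a monomial
of this weight) vanish: the kernel of the map onto the associated graded ring. -/
def gradedKernel (K : Type*) [Field K] {k : ℕ} (n : Fin k → ℕ) :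
    Ideal (MvPolynomial (Fin k) K) where
  carrier := {f | ∀ s d, (∀ c, Finsupp.weight n c = s → Finsupp.degree c ≤ d) →
    coeffSum n s d f = 0}
  add_mem' hf hg s d h := by rw [map_add, hf s d h, hg s d h, add_zero]
  zero_mem' s d _ := map_zero _
  smul_mem' g f hf := by
    induction g using MvPolynomial.induction_on' with
    | monomial c r =>
      intro s d h
      rw [smul_eq_mul, coeffSum_monomial_mul]
      split_ifs with hc
      -- A degree bound `d` in weight `s` passes to the shifted pair: multiply a monomial of the
      -- smaller weight by X^c.
      · rw [hf _ _ fun e he => ?_, mul_zero]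
        have := h (e + c) (by rw [map_add, he]; omega)
        rw [map_add] at this
        omega
      · rfl
    | add p q hp hq =>
      intro s d h
      rw [smul_eq_mul, add_mul, map_add]
      exact (congrArg₂ _ (hp s d h) (hq s d h)).trans (add_zero _)

theorem order_le_degree {f : MvPolynomial (Fin k) K} {b : Fin k →₀ ℕ} (hb : b ∈ f.support) :
    order f ≤ Finsupp.degree b :=
  Nat.sInf_le ⟨b, hb, rfl⟩

/-- The image of `f` in K[t] is zero, so its coefficients sum to zero in each weight. If `d` is both
the order of `f` and a degree bound in weight `s`, all monomials of `f` of that weight have degree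
exactly `d`, and the two sums coincide. -/
theorem initialForm_mem_gradedKernel {f : MvPolynomial (Fin k) K} (hf : f ∈ definingIdeal K n) :
    initialForm f ∈ gradedKernel K n := by
  intro s d h
  have hcomp : coeffSum n s d (initialForm f) =
      if d = order f then coeffSum n s d f else 0 := by
    rw [initialForm]
    generalize order f = e
    clear hf
    induction f using MvPolynomial.induction_on' with
    | monomial u t =>
      rw [homogeneousComponent_monomial, apply_ite (coeffSum n s d), map_zero, coeffSum_monomial]
      split_ifs with h1 h2 h3 h3 <;> first | rfl | (exfalso; omega)
    | add p q hp hq =>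
      rw [map_add, map_add, hp, hq, map_add]
      split_ifs <;> simp
  rw [hcomp]
  split_ifs with hd
  · have hs := coeff_aeval n f s
    rw [definingIdeal, RingHom.mem_ker] at hf
    have hf' : aeval (fun i => (Polynomial.X : Polynomial K) ^ n i) f = 0 := hf
    rw [hf', Polynomial.coeff_zero] at hs
    rw [coeffSum_eq_sum]; refine Eq.trans ?_ hs.symm
    refine Finset.sum_congr rfl fun b hb => ?_
    by_cases hw : Finsupp.weight n b = s
    · have h1 := h b hw
      have h2 := order_le_degree hb
      rw [if_pos hw, if_pos ⟨hw, by omega⟩]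
    · rw [if_neg hw, if_neg fun h => hw h.1]
  · rfl

theorem initialIdeal_le_gradedKernel :
    initialIdeal (definingIdeal K n) ≤ gradedKernel K n := by
  rw [initialIdeal, Ideal.span_le]
  rintro _ ⟨f, hf, rfl⟩
  exact initialForm_mem_gradedKernel n hf

end Functional

/-! ### A criterion for standard bases of ideals of initial forms -/

section Criterion

variable {K : Type*} [Field K] {k : ℕ} (n : Fin k → ℕ) (G : Set (MvPolynomial (Fin k) K))

/-- Up to sign, `G` contains the binomial `X ^ u - X ^ v`, homogeneous for the weight `n` and with
leading monomial `X ^ u`. -/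
def IsRule (u v : Fin k →₀ ℕ) : Prop :=
  Finsupp.weight n u = Finsupp.weight n v ∧ dsLT v u ∧
    (monomial u 1 - monomial v 1 ∈ G ∨ monomial v 1 - monomial u 1 ∈ G)

/-- No leading monomial of a rule divides `X ^ a`. -/
def IsNormal (a : Fin k →₀ ℕ) : Prop := ∀ u v, IsRule n G u v → ¬ u ≤ a

variable {n G}

theorem exists_isNormal (hn : ∀ i, n i ≠ 0) (a : Fin k →₀ ℕ) :
    ∃ b, IsNormal n G b ∧ Finsupp.weight n b = Finsupp.weight n a ∧ (b = a ∨ dsLT b a) := by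
  induction a using dsLT_induction hn with
  | h a ih =>
    by_cases ha : IsNormal n G a
    · exact ⟨a, ha, rfl, Or.inl rfl⟩
    · simp only [IsNormal, not_forall, not_not] at ha
      obtain ⟨u, v, huv, hua⟩ := ha
      obtain ⟨c, rfl⟩ := exists_add_of_le hua
      have hlt := dsLT_add_right huv.2.1 c
      obtain ⟨b, hb, hw, hba⟩ := ih (v + c) (by rw [map_add, map_add, huv.1]) hlt
      refine ⟨b, hb, by rw [hw, map_add, map_add, huv.1], Or.inr ?_⟩
      rcases hba with rfl | h
      · exact hlt
      · exact dsLT_trans h hlt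

/-- Rewriting `b` only descends, and by uniqueness it must end at `a`. So a normal monomial is the
least, hence of the largest degree, in its weight. -/
theorem IsNormal.eq_or_dsLT (hn : ∀ i, n i ≠ 0)
    (huniq : ∀ a b, IsNormal n G a → IsNormal n G b → Finsupp.weight n a = Finsupp.weight n b →
      a = b) {a b : Fin k →₀ ℕ} (ha : IsNormal n G a)
    (hw : Finsupp.weight n a = Finsupp.weight n b) : a = b ∨ dsLT a b := by
  obtain ⟨c, hc, hcw, hcb⟩ := exists_isNormal (G := G) hn b
  rwa [← huniq a c ha hc (hw.trans hcw.symm)] at hcb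

theorem initialForm_rule_mem {u v : Fin k →₀ ℕ} (h : IsRule n G u v) :
    initialForm (monomial u 1 - monomial v 1) ∈ Ideal.span (initialForm '' G) := by
  rcases h.2.2 with h | h
  · exact Ideal.subset_span ⟨_, h, rfl⟩
  · rw [← neg_sub, initialForm_neg]
    exact neg_mem (Ideal.subset_span ⟨_, h, rfl⟩)

/-- Modulo the initial forms of `G`, a monomial is its normal form, or zero when the latter has
larger degree. -/
theorem monomial_sub_normal_mem (hn : ∀ i, n i ≠ 0)
    (huniq : ∀ a b, IsNormal n G a → IsNormal n G b → Finsupp.weight n a = Finsupp.weight n b →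
      a = b) {a : Fin k →₀ ℕ} (ha : IsNormal n G a) (b : Fin k →₀ ℕ)
    (hw : Finsupp.weight n b = Finsupp.weight n a) :
    (monomial b 1 - if Finsupp.degree b = Finsupp.degree a then monomial a 1 else 0) ∈
      Ideal.span (initialForm '' G) := by
  induction b using dsLT_induction hn with
  | h b ih =>
    by_cases hb : IsNormal n G b
    · rw [huniq b a hb ha hw]; simp
    · simp only [IsNormal, not_forall, not_not] at hb
      obtain ⟨u, v, huv, hub⟩ := hb
      obtain ⟨c, rfl⟩ := exists_add_of_le hub
      have hwv : Finsupp.weight n (v + c) = Finsupp.weight n (u + c) := by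
        rw [map_add, map_add, huv.1]
      have hlt := dsLT_add_right huv.2.1 c
      have hr := Ideal.mul_mem_right (monomial c 1) _ (initialForm_rule_mem huv)
      have hav : Finsupp.degree (v + c) ≤ Finsupp.degree a := by
        rcases ha.eq_or_dsLT hn huniq (hwv.trans hw).symm with h | h
        · rw [h]
        · exact degree_le_of_dsLT h
      by_cases hdeg : Finsupp.degree u = Finsupp.degree v
      · rw [initialForm_binomial_of_eq huv.2.1 hdeg, sub_mul, monomial_mul, monomial_mul,
          one_mul] at hr
        have h1 := ih (v + c) hwv hlt (hwv.trans hw)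
        have h2 : Finsupp.degree (u + c) = Finsupp.degree (v + c) := by
          rw [map_add, map_add, hdeg]
        rw [h2]
        simpa using add_mem hr h1
      -- Here the initial form is the single monomial X^u, so X^(u+c) lies in the span; the normal
      -- form has degree at least that of `v + c`, so the conditional term is zero.
      · have hdeg' := lt_of_le_of_ne (degree_le_of_dsLT huv.2.1) hdeg
        rw [initialForm_binomial_of_lt hdeg', monomial_mul, one_mul] at hr
        rw [map_add] at hav
        rw [if_neg (by rw [map_add]; omega), sub_zero]
        exact hr

theorem span_initialForm_eq (hn : ∀ i, n i ≠ 0)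
    (huniq : ∀ a b, IsNormal n G a → IsNormal n G b → Finsupp.weight n a = Finsupp.weight n b →
      a = b) (hG : G ⊆ definingIdeal K n) :
    Ideal.span (initialForm '' G) = initialIdeal (definingIdeal K n) := by
  apply le_antisymm
  · rw [Ideal.span_le]
    rintro _ ⟨f, hf, rfl⟩
    exact Ideal.subset_span ⟨f, hG hf, rfl⟩
  intro f hf
  have hJ := initialIdeal_le_gradedKernel n hf
  choose nf hnf hnfw hnfle using exists_isNormal (G := G) hn
  have hsub : f - ∑ b ∈ f.support, C (coeff b f) *
      (if Finsupp.degree b = Finsupp.degree (nf b) then monomial (nf b) 1 else 0) ∈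
        Ideal.span (initialForm '' G) := by
    conv => enter [2, 1]; rw [f.as_sum]
    rw [← Finset.sum_sub_distrib]
    refine Ideal.sum_mem _ fun b _ => ?_
    have := Ideal.mul_mem_left _ (C (coeff b f))
      (monomial_sub_normal_mem hn huniq (hnf b) b (hnfw b).symm)
    rwa [mul_sub, C_mul_monomial, mul_one] at this
  -- The remainder is supported on normal monomials, and its coefficient at a normal `a` is the
  -- coefficient sum of `f` at the weight and degree of `a`, which vanishes on `gradedKernel`.
  suffices h0 : ∑ b ∈ f.support, C (coeff b f) *
      (if Finsupp.degree b = Finsupp.degree (nf b) then monomial (nf b) 1 else 0) = 0 by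
    rwa [h0, sub_zero] at hsub
  ext a
  rw [coeff_sum, coeff_zero]
  by_cases ha : IsNormal n G a
  · rw [← hJ (Finsupp.weight n a) (Finsupp.degree a) fun c hc => ?_, coeffSum_eq_sum]
    · refine Finset.sum_congr rfl fun b _ => ?_
      rw [coeff_C_mul]
      by_cases hw : Finsupp.weight n b = Finsupp.weight n a
      · rw [huniq _ _ (hnf b) ha ((hnfw b).trans hw)]
        by_cases hd : Finsupp.degree b = Finsupp.degree a <;> simp [hw, hd]
      · have hne : nf b ≠ a := fun h => hw (by rw [← h, hnfw])
        split_ifs <;> simp_all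
    · rcases ha.eq_or_dsLT hn huniq hc.symm with rfl | h
      · exact le_rfl
      · exact degree_le_of_dsLT h
  · refine Finset.sum_eq_zero fun b _ => ?_
    have hne : nf b ≠ a := fun h => ha (h ▸ hnf b)
    split_ifs <;> simp [hne]

/-- Were the leading exponent normal, it would be the least of its weight, so no other monomial of
`f` could share that weight. The coefficient sum there would be the leading coefficient, yet it must
vanish. -/
theorem exists_rule_of_isLeadingExponent (hn : ∀ i, n i ≠ 0)
    (huniq : ∀ a b, IsNormal n G a → IsNormal n G b → Finsupp.weight n a = Finsupp.weight n b →
      a = b) {f : MvPolynomial (Fin k) K} (hf : f ∈ initialIdeal (definingIdeal K n))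
    {a : Fin k →₀ ℕ} (ha : IsLeadingExponent f a) : ∃ u v, IsRule n G u v ∧ u ≤ a := by
  by_contra hcon
  have hN : IsNormal n G a := fun u v huv hu => hcon ⟨u, v, huv, hu⟩
  have h0 := initialIdeal_le_gradedKernel n hf (Finsupp.weight n a) (Finsupp.degree a)
    fun c hc => by
      rcases hN.eq_or_dsLT hn huniq hc.symm with rfl | h
      · exact le_rfl
      · exact degree_le_of_dsLT h
  rw [coeffSum_eq_sum, Finset.sum_eq_single a, if_pos ⟨rfl, rfl⟩] at h0
  · exact mem_support_iff.1 ha.1 h0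
  · intro b hb hba
    refine if_neg fun h => ?_
    rcases hN.eq_or_dsLT hn huniq h.1.symm with h' | h'
    · exact hba h'.symm
    · exact dsLT_asymm h' (ha.2 b hb hba)
  · exact fun h => (h ha.1).elim

theorem isStandardBasis_initialForm (hn : ∀ i, n i ≠ 0)
    (huniq : ∀ a b, IsNormal n G a → IsNormal n G b → Finsupp.weight n a = Finsupp.weight n b →
      a = b) (hG : G ⊆ definingIdeal K n) (hfin : G.Finite) :
    IsStandardBasis (initialForm '' G) (initialIdeal (definingIdeal K n)) := by
  have hsub : initialForm '' G ⊆ (initialIdeal (definingIdeal K n) : Set _) := by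
    rintro _ ⟨f, hf, rfl⟩
    exact Ideal.subset_span ⟨f, hG hf, rfl⟩
  refine ⟨hfin.image _, hsub, le_antisymm (Ideal.span_mono ?_) (Ideal.span_le.2 ?_)⟩
  · rintro m ⟨f, hf, h⟩
    exact ⟨f, hsub hf, h⟩
  · rintro _ ⟨f, hf, a, ha, rfl⟩
    obtain ⟨u, v, huv, hua⟩ := exists_rule_of_isLeadingExponent hn huniq hf ha
    obtain ⟨c, rfl⟩ := exists_add_of_le hua
    have hu : monomial u (1 : K) ∈ leadingIdeal (initialForm '' G) := by
      have hl := isLeadingExponent_initialForm_binomial (K := K) huv.2.1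
      rcases huv.2.2 with h | h
      · exact Ideal.subset_span ⟨_, ⟨_, h, rfl⟩, u, hl, rfl⟩
      · rw [← neg_sub, initialForm_neg, isLeadingExponent_neg] at hl
        exact Ideal.subset_span ⟨_, ⟨_, h, rfl⟩, u, hl, rfl⟩
    have := Ideal.mul_mem_right (monomial c 1) _ hu
    rwa [monomial_mul, one_mul] at this

end Criterion

namespace Params

variable {p : Params}

/-! ### The relations between the generators -/

/-- The weight identities behind f_{1,0}, f₂, f₃, f₄ and g_{0,0}; those of the remaining f_{1,j} and
g_{j,i} are integer combinations of the first, second and fifth. -/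
theorem gen_relations (hp : p.Admissible) :
    p.α₁ * p.gen 0 = p.gen 2 + (p.α₄ - 1) * p.gen 3 ∧
    p.α₂ * p.gen 1 = p.α₂₁ * p.gen 0 + p.gen 3 ∧
    p.α₃ * p.gen 2 = (p.α₁ - p.α₂₁ - 1) * p.gen 0 + p.gen 1 ∧
    p.α₄ * p.gen 3 = p.gen 0 + (p.α₂ - 1) * p.gen 1 + (p.α₃ - 1) * p.gen 2 ∧
    p.gen 1 + (p.α₄ - 1) * p.gen 3 = (p.α₂₁ + 1) * p.gen 0 + (p.α₃ - 1) * p.gen 2 := by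
  obtain ⟨α₁, α₂, α₃, α₄, σ⟩ := p
  obtain ⟨h1, h2, h3, h4, h5, h6⟩ := hp
  dsimp only at *
  obtain ⟨γ, rfl⟩ : ∃ γ, α₁ = γ + 1 + σ := ⟨α₁ - 1 - σ, by omega⟩
  obtain ⟨β, rfl⟩ : ∃ β, α₂ = β + 1 := ⟨α₂ - 1, by omega⟩
  obtain ⟨c, rfl⟩ : ∃ c, α₃ = c + 1 := ⟨α₃ - 1, by omega⟩
  obtain ⟨m, rfl⟩ : ∃ m, α₄ = m + 1 := ⟨α₄ - 1, by omega⟩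
  have e2 : (γ + 1 + σ) * (m + 1) + γ * β * m - (m + 1) + 1 =
      (γ + σ) * (m + 1) + γ * β * m + 1 := by
    have : (γ + 1 + σ) * (m + 1) + γ * β * m = (γ + σ) * (m + 1) + γ * β * m + (m + 1) := by ring
    omega
  simp only [gen, Nat.add_sub_cancel, e2, Matrix.cons_val]
  refine ⟨?_, ?_, ?_, ?_, ?_⟩ <;> ring

variable (p) in
/-- The weight of `X₁ ^ a X₂ ^ b X₃ ^ c X₄ ^ d`. -/
def wt (a b c d : ℕ) : ℕ := a * p.gen 0 + b * p.gen 1 + c * p.gen 2 + d * p.gen 3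

/-! ### Reduced monomials and the Apéry set of the first generator -/

variable (p) in
/-- The monomials `X₂ ^ b X₃ ^ c X₄ ^ d` whose weights form the Apéry set of `n₁`. -/
def reduced : Finset (ℕ × ℕ × ℕ) :=
  insert (0, 0, p.α₄ - 1)
    (Finset.range p.α₂ ×ˢ Finset.range p.α₃ ×ˢ Finset.range (p.α₄ - 1))

theorem mem_reduced {b c d : ℕ} : (b, c, d) ∈ p.reduced ↔
    (b = 0 ∧ c = 0 ∧ d = p.α₄ - 1) ∨ (b < p.α₂ ∧ c < p.α₃ ∧ d < p.α₄ - 1) := by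
  simp [reduced]

theorem card_reduced : p.reduced.card = p.gen 0 := by
  rw [reduced, Finset.card_insert_of_notMem (by simp)]
  simp [gen, mul_assoc]

/-- Each relation trades other variables for a positive power of X₁, so the weight carried by X₂,
X₃, X₄ drops and the process ends. -/
theorem exists_reduced (hp : p.Admissible) (a b c d : ℕ) :
    ∃ a' b' c' d', (b', c', d') ∈ p.reduced ∧ p.wt a' b' c' d' = p.wt a b c d ∧
      (a < a' ∨ (a = a' ∧ b = b' ∧ c = c' ∧ d = d')) := by
  obtain ⟨r1, r2, r3, r4, r5⟩ := gen_relations hp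
  have h0 : 0 < p.gen 0 := Nat.succ_pos _
  obtain ⟨h1, h2, h3, h4, h5, h6⟩ := hp
  induction hN : b * p.gen 1 + c * p.gen 2 + d * p.gen 3 using Nat.strong_induction_on
    generalizing a b c d with
  | _ N ih =>
    subst hN
    have key : ∀ x b' c' d', 0 < x → p.wt (a + x) b' c' d' = p.wt a b c d →
        ∃ a' b' c' d', (b', c', d') ∈ p.reduced ∧ p.wt a' b' c' d' = p.wt a b c d ∧
          (a < a' ∨ (a = a' ∧ b = b' ∧ c = c' ∧ d = d')) := by
      intro x b' c' d' hx hw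
      have hlt : b' * p.gen 1 + c' * p.gen 2 + d' * p.gen 3 <
          b * p.gen 1 + c * p.gen 2 + d * p.gen 3 := by
        rw [wt, wt, add_mul] at hw
        have := Nat.mul_pos hx h0
        omega
      obtain ⟨a₁, b₁, c₁, d₁, hr, hw₁, ha⟩ := ih _ hlt (a + x) b' c' d' rfl
      exact ⟨a₁, b₁, c₁, d₁, hr, hw₁.trans hw, Or.inl (by omega)⟩
    by_cases hb : p.α₂ ≤ b
    · obtain ⟨t, rfl⟩ := Nat.exists_eq_add_of_le hb
      exact key p.α₂₁ t c (d + 1) h5 (by simp only [wt]; linarith)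
    by_cases hc : p.α₃ ≤ c
    · obtain ⟨t, rfl⟩ := Nat.exists_eq_add_of_le hc
      exact key (p.α₁ - p.α₂₁ - 1) (b + 1) t d (by omega) (by simp only [wt]; linarith)
    by_cases hd : p.α₄ ≤ d
    · obtain ⟨t, rfl⟩ := Nat.exists_eq_add_of_le hd
      exact key 1 (b + (p.α₂ - 1)) (c + (p.α₃ - 1)) t one_pos (by simp only [wt]; linarith)
    by_cases hd' : p.α₄ - 1 ≤ d
    · obtain ⟨t, rfl⟩ := Nat.exists_eq_add_of_le hd'
      rcases Nat.eq_zero_or_pos c with rfl | hc0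
      · rcases Nat.eq_zero_or_pos b with rfl | hb0
        · exact ⟨a, 0, 0, _, mem_reduced.2 (Or.inl ⟨rfl, rfl, by omega⟩), rfl,
            Or.inr ⟨rfl, rfl, rfl, rfl⟩⟩
        · obtain ⟨b, rfl⟩ := Nat.exists_eq_add_of_le hb0
          exact key (p.α₂₁ + 1) b (p.α₃ - 1) t (by omega) (by simp only [wt]; linarith)
      · obtain ⟨c, rfl⟩ := Nat.exists_eq_add_of_le hc0
        exact key p.α₁ b c t (by omega) (by simp only [wt]; linarith)
    · exact ⟨a, b, c, d, mem_reduced.2 (Or.inr ⟨by omega, by omega, by omega⟩), rfl,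
        Or.inr ⟨rfl, rfl, rfl, rfl⟩⟩

/-- Pigeonhole: n₁ reduced monomials cover the n₁ residues mod n₁, hence represent each exactly
once; the power of X₁ is then fixed by the weight. -/
theorem reduced_unique (hp : p.Admissible)
    (hS : IsPseudoSymmetric (AddSubmonoid.closure (Set.range p.gen)))
    {a b c d a' b' c' d' : ℕ} (h : (b, c, d) ∈ p.reduced) (h' : (b', c', d') ∈ p.reduced)
    (hw : p.wt a b c d = p.wt a' b' c' d') : a = a' ∧ b = b' ∧ c = c' ∧ d = d' := by
  have h0 : 0 < p.gen 0 := Nat.succ_pos _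
  have : NeZero (p.gen 0) := ⟨h0.ne'⟩
  let f : ℕ × ℕ × ℕ → ZMod (p.gen 0) := fun t => (p.wt 0 t.1 t.2.1 t.2.2 : ℕ)
  have hf : ∀ a b c d, ((p.wt a b c d : ℕ) : ZMod (p.gen 0)) = f (b, c, d) := by
    intro a b c d
    simp [f, wt]
  have hsurj : Set.SurjOn f p.reduced (Finset.univ : Finset (ZMod (p.gen 0))) := by
    intro z _
    obtain ⟨F, -, -, hF, -⟩ := hS
    -- A multiple of n₁ pushes the residue past the Frobenius number, into the semigroup.
    have hx := hF (z.val + p.gen 0 * (F + 1)) (by nlinarith)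
    rw [AddSubmonoid.mem_closure_range_iff_of_fintype] at hx
    obtain ⟨e, he⟩ := hx
    have he' : p.wt (e 0) (e 1) (e 2) (e 3) = z.val + p.gen 0 * (F + 1) := by
      rw [he, Fin.sum_univ_four]; rfl
    obtain ⟨a', b', c', d', hr, hw', -⟩ := exists_reduced hp (e 0) (e 1) (e 2) (e 3)
    refine ⟨(b', c', d'), hr, ?_⟩
    rw [← hf a', hw', he']
    simp
  have hinj := Finset.injOn_of_surjOn_of_card_le f (fun _ _ => Finset.mem_coe.2 (Finset.mem_univ _))
    hsurj (by rw [card_reduced, Finset.card_univ, ZMod.card])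
  have heq : f (b, c, d) = f (b', c', d') := by rw [← hf a, ← hf a', hw]
  have ht := hinj h h' heq
  simp only [Prod.mk.injEq] at ht
  obtain ⟨rfl, rfl, rfl⟩ := ht
  refine ⟨?_, rfl, rfl, rfl⟩
  simp only [wt, add_left_inj] at hw
  exact Nat.eq_of_mul_eq_mul_right h0 hw

/-- No other monomial has the weight of `X₄`. -/
theorem eq_of_wt_eq_gen_three (hp : p.Admissible)
    (hS : IsPseudoSymmetric (AddSubmonoid.closure (Set.range p.gen)))
    {a b c d : ℕ} (hw : p.wt a b c d = p.gen 3) : a = 0 ∧ b = 0 ∧ c = 0 ∧ d = 1 := by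
  obtain ⟨a', b', c', d', hr, hw', h⟩ := exists_reduced hp a b c d
  obtain ⟨h1, h2, h3, h4, -⟩ := id hp
  have hr' : (0, 0, 1) ∈ p.reduced := by
    rw [mem_reduced]
    omega
  have := reduced_unique hp hS (a' := 0) hr hr' (by rw [hw', hw]; simp [wt])
  omega

/-! ### Standard monomials have distinct weights -/

variable (p) in
/-- The two monomials of `g_{j,i}` have the same degree and `X₂ ^ _` is the leading one. -/
def IsTie (j i : ℕ) : Prop := j + 1 = p.α₄ ∧ p.degLeft j i = p.degRight j i

variable (p) in
/-- `X₁ ^ a X₂ ^ b X₃ ^ c X₄ ^ d` is divisible by none of the leading monomials of the initial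
forms of the elements of `G`. -/
structure IsStd (a b c d : ℕ) : Prop where
  f₁ : ∀ j < p.α₄, j * p.α₂ ≤ b → p.α₄ - (j + 1) ≤ d → c = 0
  f₂ : p.α₂₁ ≤ a → d = 0
  f₃ : c < p.α₃
  f₄ : d < p.α₄
  g_last : ∀ j < p.α₄, ((p.α₄ - 1) * p.s j + j) * p.α₂ + 1 ≤ b → d < p.α₄ - (j + 1)
  g_tie : ∀ j < p.α₄, ∀ i, p.sPrev j ≤ i → i < p.s j → p.IsTie j i →
    b < ((p.α₄ - 1) * i + j) * p.α₂ + 1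
  g_right : ∀ j < p.α₄, ∀ i, p.sPrev j ≤ i → i < p.s j → ¬ p.IsTie j i →
    i * p.α₁ + ((p.α₄ - 1) * i + j + 1) * p.α₂₁ + 1 ≤ a → c < p.α₃ - (i + 1)

variable (p) in
/-- The standard monomials whose reduction uses `X₂ X₄ ^ (α₄ - 1) = X₁ ^ (α₂₁ + 1) X₃ ^ (α₃ - 1)`. -/
def IsLong (b c d : ℕ) : Prop := c = 0 ∧ 1 ≤ b ∧ p.α₄ - 1 ≤ (b - 1) / p.α₂ + d

theorem wt_short (hp : p.Admissible) (a b c d : ℕ) :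
    p.wt a b c d = p.wt (a + b / p.α₂ * p.α₂₁) (b % p.α₂) c (b / p.α₂ + d) := by
  obtain ⟨-, r2, -⟩ := gen_relations hp
  have hb := Nat.div_add_mod b p.α₂
  generalize b / p.α₂ = q at *
  generalize b % p.α₂ = r at *
  subst hb
  zify at *
  simp only [wt]
  push_cast
  linear_combination (q : ℤ) * r2

theorem IsStd.short_mem_reduced (hp : p.Admissible) {a b c d : ℕ} (h : p.IsStd a b c d)
    (hl : ¬ p.IsLong b c d) : (b % p.α₂, c, b / p.α₂ + d) ∈ p.reduced := by
  obtain ⟨h1, h2, h3, h4, h5, h6⟩ := hp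
  have hr : b % p.α₂ < p.α₂ := Nat.mod_lt _ (by omega)
  rw [mem_reduced]
  by_cases hlt : b / p.α₂ + d < p.α₄ - 1
  · exact Or.inr ⟨hr, h.f₃, hlt⟩
  have hc : c = 0 := by
    -- The minimum keeps the index of f_{1,j} below α₄.
    refine h.f₁ (min (b / p.α₂) (p.α₄ - 1)) (by omega) ?_ (by omega)
    exact (Nat.mul_le_mul_right _ (min_le_left _ _)).trans (Nat.div_mul_le_self _ _)
  have hd := h.f₄
  subst hc
  rcases Nat.eq_zero_or_pos b with rfl | hb
  · rw [Nat.zero_div] at hlt ⊢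
    exact Or.inl ⟨Nat.zero_mod _, rfl, by omega⟩
  · have hq : (b - 1) / p.α₂ + d < p.α₄ - 1 := by
      by_contra hq
      exact hl ⟨rfl, hb, by omega⟩
    obtain ⟨e, rfl⟩ : ∃ e, b = e + 1 := ⟨b - 1, by omega⟩
    rw [Nat.add_sub_cancel] at hq
    rw [Nat.succ_div] at hlt ⊢
    by_cases hdvd : p.α₂ ∣ e + 1
    · rw [if_pos hdvd] at hlt ⊢
      exact Or.inl ⟨Nat.mod_eq_zero_of_dvd hdvd, rfl, by omega⟩
    · rw [if_neg hdvd] at hlt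
      omega

/-- Replace X₂^α₂ as often as the exponent b - 1 allows (`q` times), then X₂ X₄^(α₄-1) once by
X₁^(α₂₁+1) X₃^(α₃-1), then X₃ X₄^(α₄-1) by X₁^α₁ `i` times. The bound on `i` holds because otherwise
the leading monomial of g_{j,s_j} with j = α₄ - 1 - d would divide the monomial. -/
theorem IsStd.exists_long (hp : p.Admissible) (hs : ∀ j < p.α₄, p.s j ≤ p.α₃ - 1)
    {a b c d : ℕ} (h : p.IsStd a b c d) (hl : p.IsLong b c d) :
    ∃ q r i l e, b = q * p.α₂ + r + 1 ∧ q + d = (p.α₄ - 1) * (i + 1) + l ∧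
      i < p.s (p.α₄ - 1 - d) ∧ i + e + 1 = p.α₃ ∧ 1 ≤ e ∧ (r, e, l) ∈ p.reduced ∧
      p.wt a b c d = p.wt (a + (q + 1) * p.α₂₁ + 1 + i * p.α₁) r e l := by
  obtain ⟨r1, r2, -, -, r5⟩ := gen_relations hp
  obtain ⟨h1, h2, h3, h4, h5, h6⟩ := hp
  have hd := h.f₄
  have hlast := h.g_last (p.α₄ - 1 - d) (by omega)
  have hs' := hs (p.α₄ - 1 - d) (by omega)
  obtain ⟨rfl, hb, hq⟩ := hl
  obtain ⟨b, rfl⟩ : ∃ e, b = e + 1 := ⟨b - 1, by omega⟩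
  rw [Nat.add_sub_cancel] at hq
  have hbq := Nat.div_add_mod' b p.α₂
  have hr : b % p.α₂ < p.α₂ := Nat.mod_lt _ (by omega)
  generalize b / p.α₂ = q at *
  generalize b % p.α₂ = r at *
  subst hbq
  obtain ⟨t, ht⟩ := Nat.exists_eq_add_of_le hq
  have hm : 0 < p.α₄ - 1 := by omega
  have htm := Nat.div_add_mod t (p.α₄ - 1)
  have hl : t % (p.α₄ - 1) < p.α₄ - 1 := Nat.mod_lt _ hm
  generalize t / (p.α₄ - 1) = i at *
  generalize t % (p.α₄ - 1) = l at *
  subst htm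
  have hi : i < p.s (p.α₄ - 1 - d) := by
    by_contra hi
    have hle : (p.α₄ - 1) * p.s (p.α₄ - 1 - d) ≤ (p.α₄ - 1) * i :=
      Nat.mul_le_mul_left _ (by omega)
    have : ((p.α₄ - 1) * p.s (p.α₄ - 1 - d) + (p.α₄ - 1 - d)) * p.α₂ ≤ q * p.α₂ :=
      Nat.mul_le_mul_right _ (by omega)
    have := hlast (by omega)
    omega
  obtain ⟨e, he⟩ : ∃ e, i + e + 1 = p.α₃ := ⟨p.α₃ - 1 - i, by omega⟩
  refine ⟨q, r, i, l, e, rfl, by rw [ht]; ring, hi, he, by omega,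
    mem_reduced.2 (Or.inr ⟨hr, by omega, hl⟩), ?_⟩
  rw [show p.α₃ - 1 = i + e by omega] at r5
  generalize p.α₄ - 1 = m at *
  zify at *
  simp only [wt]
  push_cast
  linear_combination (q : ℤ) * r2 + (p.gen 3 : ℤ) * ht + r5 - (i : ℤ) * r1

/-- The exponents of `X₁` and `X₄` are determined by those of the reduced monomial. -/
theorem eq_of_mixed_eq {σ a q d a' q' d' : ℕ} (h : a + q * σ = a' + q' * σ)
    (hd : q + d = q' + d') (h2 : σ ≤ a → d = 0) (h2' : σ ≤ a' → d' = 0) :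
    a = a' ∧ q = q' ∧ d = d' := by
  have key : ∀ {a q d a' q' d' : ℕ}, a + q * σ = a' + q' * σ → q + d = q' + d' →
      (σ ≤ a → d = 0) → ¬ q < q' := by
    -- If q < q', then a exceeds a' by at least σ, forcing d = 0 and q = q' + d' ≥ q'.
    intro a q d a' q' d' h hd h2 hlt
    obtain ⟨t, rfl⟩ := Nat.exists_eq_add_of_lt hlt
    have := h2 (by nlinarith)
    omega
  have hq : q = q' := le_antisymm (not_lt.1 (key h.symm hd.symm h2')) (not_lt.1 (key h hd h2))
  subst hq
  omega

theorem IsStd.short_ne_long (hp : p.Admissible)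
    (hS : IsPseudoSymmetric (AddSubmonoid.closure (Set.range p.gen)))
    (hs : ∀ j < p.α₄, p.s j ≤ p.α₃ - 1) {a b c d a' b' c' d' : ℕ}
    (h : p.IsStd a b c d) (h' : p.IsStd a' b' c' d') (hl : ¬ p.IsLong b c d)
    (hl' : p.IsLong b' c' d') : p.wt a b c d ≠ p.wt a' b' c' d' := by
  intro hw
  obtain ⟨q, r, i, l, e, rfl, hql, hi, he, he1, hred, hw'⟩ := h'.exists_long hp hs hl'
  rw [wt_short hp a, hw'] at hw
  obtain ⟨ha, hr, hc, hd⟩ := reduced_unique hp hS (h.short_mem_reduced hp hl) hred hw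
  have hd' := h'.f₄
  have hex : ∃ j, i < p.s j := ⟨_, hi⟩
  classical
  -- The least such `j` satisfies s_{j-1} ≤ i < s_j, so g_{j,i} belongs to `G`. Its leading monomial
  -- divides the long monomial in case of a tie, and the short one otherwise.
  obtain ⟨j, hj, hmin⟩ : ∃ j, i < p.s j ∧ ∀ j' < j, ¬ i < p.s j' :=
    ⟨Nat.find hex, Nat.find_spec hex, fun _ => Nat.find_min hex⟩
  have hjd : j ≤ p.α₄ - 1 - d' := by
    by_contra hcon
    exact hmin _ (not_le.1 hcon) hi
  have hprev : p.sPrev j ≤ i := by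
    cases j with
    | zero => exact Nat.zero_le _
    | succ j => exact not_lt.1 (hmin j (Nat.lt_succ_self j))
  have hj4 : j < p.α₄ := by omega
  rw [mul_add, mul_one] at hql
  by_cases htie : p.IsTie j i
  · have := h'.g_tie j hj4 i hprev hj htie
    have hj1 := htie.1
    have : ((p.α₄ - 1) * i + j) * p.α₂ ≤ q * p.α₂ := Nat.mul_le_mul_right _ (by omega)
    omega
  · have hlt := h.g_right j hj4 i hprev hj htie ?_
    · omega
    · have : ((p.α₄ - 1) * i + j + 1 + b / p.α₂) * p.α₂₁ ≤ (q + 1) * p.α₂₁ :=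
        Nat.mul_le_mul_right _ (by omega)
      rw [add_mul _ (b / p.α₂)] at this
      omega

theorem IsStd.eq_of_wt_eq (hp : p.Admissible)
    (hS : IsPseudoSymmetric (AddSubmonoid.closure (Set.range p.gen)))
    (hs : ∀ j < p.α₄, p.s j ≤ p.α₃ - 1) {a b c d a' b' c' d' : ℕ}
    (h : p.IsStd a b c d) (h' : p.IsStd a' b' c' d')
    (hw : p.wt a b c d = p.wt a' b' c' d') : a = a' ∧ b = b' ∧ c = c' ∧ d = d' := by
  by_cases hl : p.IsLong b c d <;> by_cases hl' : p.IsLong b' c' d'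
  · obtain ⟨q, r, i, l, e, rfl, hql, hi, he, he1, hred, hw1⟩ := h.exists_long hp hs hl
    obtain ⟨q', r', i', l', e', rfl, hql', hi', he', he1', hred', hw1'⟩ := h'.exists_long hp hs hl'
    rw [hw1, hw1'] at hw
    obtain ⟨ha, rfl, rfl, rfl⟩ := reduced_unique hp hS hred hred' hw
    obtain rfl : i = i' := by omega
    rw [add_mul, add_mul] at ha
    obtain ⟨rfl, rfl, rfl⟩ := eq_of_mixed_eq (by omega) (hql.trans hql'.symm) h.f₂ h'.f₂
    exact ⟨rfl, rfl, hl.1.trans hl'.1.symm, rfl⟩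
  · exact (h'.short_ne_long hp hS hs h hl' hl hw.symm).elim
  · exact (h.short_ne_long hp hS hs h' hl hl' hw).elim
  · rw [wt_short hp a, wt_short hp a'] at hw
    obtain ⟨ha, hr, hc, hd⟩ := reduced_unique hp hS (h.short_mem_reduced hp hl)
      (h'.short_mem_reduced hp hl') hw
    obtain ⟨ha', hq, hd'⟩ := eq_of_mixed_eq ha hd h.f₂ h'.f₂
    refine ⟨ha', ?_, hc, hd'⟩
    rw [← Nat.div_add_mod b p.α₂, ← Nat.div_add_mod b' p.α₂, hq, hr]

end Params

/-! ### Exponents in four variables -/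

/-- The exponent of `X₁ ^ a X₂ ^ b X₃ ^ c X₄ ^ d`. -/
def expo (a b c d : ℕ) : Fin 4 →₀ ℕ := Finsupp.equivFunOnFinite.symm ![a, b, c, d]

theorem exists_eq_expo (x : Fin 4 →₀ ℕ) : ∃ a b c d, x = expo a b c d :=
  ⟨x 0, x 1, x 2, x 3, by ext i; fin_cases i <;> rfl⟩

theorem expo_le_expo {a b c d a' b' c' d' : ℕ} :
    expo a b c d ≤ expo a' b' c' d' ↔ a ≤ a' ∧ b ≤ b' ∧ c ≤ c' ∧ d ≤ d' := by
  rw [Finsupp.le_def]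
  simp [Fin.forall_fin_succ, expo]

theorem degree_expo (a b c d : ℕ) : Finsupp.degree (expo a b c d) = a + b + c + d := by
  rw [Finsupp.degree_eq_sum, Fin.sum_univ_four]; rfl

theorem weight_expo (p : Params) (a b c d : ℕ) :
    Finsupp.weight p.gen (expo a b c d) = p.wt a b c d := by
  rw [Finsupp.weight_eq_sum, Fin.sum_univ_four]; rfl

theorem monomial_expo (K : Type*) [Field K] (a b c d : ℕ) :
    (monomial (expo a b c d) 1 : MvPolynomial (Fin 4) K) = X 0 ^ a * X 1 ^ b * X 2 ^ c * X 3 ^ d := by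
  rw [monomial_eq, Finsupp.prod_fintype _ _ (fun i => pow_zero _), Fin.prod_univ_four, C_1, one_mul]
  rfl

namespace Params

variable {p : Params}

/-! ### The numbers `s_j` -/

/-- With the next lemma: n₁ and n₂ are the degrees of the two monomials of g_{α₄-1,α₃-1}, so n₁ < n₂
is the inequality defining s_{α₄-1} at α₃ - 1. -/
theorem cast_gen_zero (hp : p.Admissible) :
    (p.gen 0 : ℤ) = p.degLeft (p.α₄ - 1) (p.α₃ - 1) := by
  obtain ⟨h1, h2, h3, h4, h5, h6⟩ := hp
  simp only [gen, degLeft, Matrix.cons_val]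
  push_cast [Nat.cast_sub h3.le, Nat.cast_sub h4.le]
  ring

theorem cast_gen_one (hp : p.Admissible) :
    (p.gen 1 : ℤ) = p.degRight (p.α₄ - 1) (p.α₃ - 1) := by
  obtain ⟨h1, h2, h3, h4, h5, h6⟩ := hp
  simp only [gen, degRight, Matrix.cons_val]
  rw [Nat.sub_sub]
  push_cast [Nat.cast_sub h3.le, Nat.cast_sub h4.le, Nat.cast_sub (show p.α₂₁ + 1 ≤ p.α₁ by omega)]
  ring

/-- The left degree minus the right degree grows with `j` at rate α₂ - α₂₁ - 1 > 0, so j = α₄ - 1 is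
the worst case. The same monotonicity makes s_j nondecreasing in `j`. -/
theorem degLeft_lt_degRight_last (hp : p.Admissible) (h12 : p.gen 0 < p.gen 1)
    (hα : p.α₂₁ + 1 < p.α₂) {j : ℕ} (hj : j < p.α₄) :
    p.degLeft j (p.α₃ - 1) < p.degRight j (p.α₃ - 1) := by
  have h : (p.gen 0 : ℤ) < p.gen 1 := by exact_mod_cast h12
  rw [cast_gen_zero hp, cast_gen_one hp] at h
  obtain ⟨t, ht⟩ : ∃ t, p.α₄ - 1 = j + t := ⟨p.α₄ - 1 - j, by omega⟩
  obtain ⟨e, he⟩ := Nat.exists_eq_add_of_lt hα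
  rw [ht] at h
  simp only [degLeft, degRight] at h ⊢
  rw [he] at h ⊢
  push_cast at h ⊢
  have : (0 : ℤ) ≤ t * e := by positivity
  nlinarith

theorem s_le (hp : p.Admissible) (h12 : p.gen 0 < p.gen 1) (hα : p.α₂₁ + 1 < p.α₂) {j : ℕ}
    (hj : j < p.α₄) : p.s j ≤ p.α₃ - 1 :=
  Nat.sInf_le (degLeft_lt_degRight_last hp h12 hα hj)

theorem degLeft_lt_degRight_s (hp : p.Admissible) (h12 : p.gen 0 < p.gen 1)
    (hα : p.α₂₁ + 1 < p.α₂) {j : ℕ} (hj : j < p.α₄) :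
    p.degLeft j (p.s j) < p.degRight j (p.s j) :=
  Nat.sInf_mem (s := {i | p.degLeft j i < p.degRight j i})
    ⟨_, degLeft_lt_degRight_last hp h12 hα hj⟩

theorem degRight_le_degLeft {i j : ℕ} (hi : i < p.s j) : p.degRight j i ≤ p.degLeft j i :=
  not_lt.1 (Nat.notMem_of_lt_sInf hi)

theorem sPrev_le_s (hp : p.Admissible) (h12 : p.gen 0 < p.gen 1) (hα : p.α₂₁ + 1 < p.α₂) {j : ℕ}
    (hj : j < p.α₄) : p.sPrev j ≤ p.s j := by
  cases j with
  | zero => exact Nat.zero_le _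
  | succ j =>
    refine Nat.sInf_le (m := p.s (j + 1)) ?_
    have h := degLeft_lt_degRight_s hp h12 hα hj
    generalize p.s (j + 1) = i at h ⊢
    change p.degLeft j i < p.degRight j i
    have hα' : (p.α₂₁ : ℤ) + 1 < p.α₂ := by exact_mod_cast hα
    simp only [degLeft, degRight] at h ⊢
    push_cast at h
    nlinarith

/-! ### The exponents of the elements of `G` -/

variable (p) in
/-- The exponent of the first monomial of `g_{j,i}`. -/
def leftExpo (j i : ℕ) : Fin 4 →₀ ℕ :=
  expo 0 (((p.α₄ - 1) * i + j) * p.α₂ + 1) 0 (p.α₄ - (j + 1))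

variable (p) in
/-- The exponent of the second monomial of `g_{j,i}`. -/
def rightExpo (j i : ℕ) : Fin 4 →₀ ℕ :=
  expo (i * p.α₁ + ((p.α₄ - 1) * i + j + 1) * p.α₂₁ + 1) 0 (p.α₃ - (i + 1)) 0

theorem degree_leftExpo {j i : ℕ} (hj : j < p.α₄) :
    ((Finsupp.degree (p.leftExpo j i) : ℕ) : ℤ) = p.degLeft j i := by
  rw [leftExpo, degree_expo, degLeft]
  push_cast [Nat.cast_sub (Nat.succ_le_of_lt hj), Nat.cast_sub (Nat.one_le_of_lt hj)]
  ring

theorem degree_rightExpo {j i : ℕ} (hp : p.Admissible) (hi : i < p.α₃) :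
    ((Finsupp.degree (p.rightExpo j i) : ℕ) : ℤ) = p.degRight j i := by
  have h4 := hp.2.2.2.1
  rw [rightExpo, degree_expo, degRight]
  push_cast [Nat.cast_sub (Nat.succ_le_of_lt hi), Nat.cast_sub h4.le]
  ring

theorem weight_leftExpo (hp : p.Admissible) {j i : ℕ} (hj : j < p.α₄) (hi : i < p.α₃) :
    Finsupp.weight p.gen (p.leftExpo j i) = Finsupp.weight p.gen (p.rightExpo j i) := by
  obtain ⟨r1, r2, -, -, r5⟩ := gen_relations hp
  rw [leftExpo, rightExpo, weight_expo, weight_expo]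
  obtain ⟨t, ht⟩ : ∃ t, p.α₄ - (j + 1) = t := ⟨_, rfl⟩
  obtain ⟨e, he⟩ : ∃ e, p.α₃ - (i + 1) = e := ⟨_, rfl⟩
  rw [show p.α₄ - 1 = j + t by omega] at *
  rw [show p.α₃ - 1 = i + e by omega] at *
  rw [ht, he]
  simp only [wt]
  zify at *
  linear_combination (((j : ℤ) + t) * i + j) * r2 + r5 - (i : ℤ) * r1

variable (K : Type*) [Field K]

theorem gLeft_eq (j i : ℕ) : p.gLeft K j i = monomial (p.leftExpo j i) 1 := by
  rw [leftExpo, monomial_expo, gLeft]; ring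

theorem gRight_eq (j i : ℕ) : p.gRight K j i = monomial (p.rightExpo j i) 1 := by
  rw [rightExpo, monomial_expo, gRight]; ring

theorem f₁_eq (j : ℕ) : p.f₁ K j = monomial (expo (p.α₁ + j * p.α₂₁) 0 0 0) 1 -
    monomial (expo 0 (j * p.α₂) 1 (p.α₄ - (j + 1))) 1 := by
  rw [monomial_expo, monomial_expo, f₁]; ring

theorem f₂_eq : p.f₂ K = monomial (expo 0 p.α₂ 0 0) 1 - monomial (expo p.α₂₁ 0 0 1) 1 := by
  rw [monomial_expo, monomial_expo, f₂]; ring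

theorem f₃_eq : p.f₃ K =
    monomial (expo 0 0 p.α₃ 0) 1 - monomial (expo (p.α₁ - p.α₂₁ - 1) 1 0 0) 1 := by
  rw [monomial_expo, monomial_expo, f₃]; ring

theorem f₄_eq : p.f₄ K =
    monomial (expo 0 0 0 p.α₄) 1 - monomial (expo 1 (p.α₂ - 1) (p.α₃ - 1) 0) 1 := by
  rw [monomial_expo, monomial_expo, f₄]; ring

/-! ### Weights and degrees of the monomials of the binomials -/

theorem weight_f₁ (hp : p.Admissible) {j : ℕ} (hj : j < p.α₄) :
    Finsupp.weight p.gen (expo 0 (j * p.α₂) 1 (p.α₄ - (j + 1))) =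
      Finsupp.weight p.gen (expo (p.α₁ + j * p.α₂₁) 0 0 0) := by
  obtain ⟨r1, r2, -⟩ := gen_relations hp
  rw [weight_expo, weight_expo]
  obtain ⟨t, ht⟩ : ∃ t, p.α₄ - (j + 1) = t := ⟨_, rfl⟩
  rw [show p.α₄ - 1 = j + t by omega] at r1
  rw [ht]
  simp only [wt]
  zify at *
  linear_combination (j : ℤ) * r2 - r1

/-- At equal weight, the monomial in lighter variables has the larger degree; the same comparison
settles f₃ and f₄. -/
theorem degree_f₁ (hp : p.Admissible) (h12 : p.gen 0 < p.gen 1) (h23 : p.gen 1 < p.gen 2)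
    (h34 : p.gen 2 < p.gen 3) {j : ℕ} (hj : j < p.α₄) :
    Finsupp.degree (expo 0 (j * p.α₂) 1 (p.α₄ - (j + 1))) <
      Finsupp.degree (expo (p.α₁ + j * p.α₂₁) 0 0 0) := by
  have h := weight_f₁ hp hj
  rw [weight_expo, weight_expo] at h
  rw [degree_expo, degree_expo]
  simp only [wt] at h
  generalize p.α₁ + j * p.α₂₁ = a at *
  generalize j * p.α₂ = b at *
  generalize p.α₄ - (j + 1) = d at *
  have h0 : 0 < p.gen 0 := Nat.succ_pos _
  have hb := Nat.mul_le_mul_left b h12.le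
  have hd := Nat.mul_le_mul_left d (h12.trans (h23.trans h34)).le
  refine lt_of_mul_lt_mul_right ?_ (Nat.zero_le (p.gen 0))
  simp only [add_mul]
  omega

theorem weight_f₂ (hp : p.Admissible) :
    Finsupp.weight p.gen (expo p.α₂₁ 0 0 1) = Finsupp.weight p.gen (expo 0 p.α₂ 0 0) := by
  obtain ⟨-, r2, -⟩ := gen_relations hp
  rw [weight_expo, weight_expo]
  simp only [wt]
  omega

theorem weight_f₃ (hp : p.Admissible) :
    Finsupp.weight p.gen (expo 0 0 p.α₃ 0) =
      Finsupp.weight p.gen (expo (p.α₁ - p.α₂₁ - 1) 1 0 0) := by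
  obtain ⟨-, -, r3, -⟩ := gen_relations hp
  rw [weight_expo, weight_expo]
  simp only [wt]
  omega

theorem degree_f₃ (hp : p.Admissible) (h12 : p.gen 0 < p.gen 1) (h23 : p.gen 1 < p.gen 2) :
    Finsupp.degree (expo 0 0 p.α₃ 0) <
      Finsupp.degree (expo (p.α₁ - p.α₂₁ - 1) 1 0 0) := by
  obtain ⟨-, -, r3, -⟩ := gen_relations hp
  rw [degree_expo, degree_expo]
  have := Nat.mul_le_mul_left (p.α₁ - p.α₂₁ - 1) (h12.trans h23).le
  refine lt_of_mul_lt_mul_right ?_ (Nat.zero_le (p.gen 2))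
  simp only [add_mul]
  omega

theorem weight_f₄ (hp : p.Admissible) :
    Finsupp.weight p.gen (expo 0 0 0 p.α₄) =
      Finsupp.weight p.gen (expo 1 (p.α₂ - 1) (p.α₃ - 1) 0) := by
  obtain ⟨-, -, -, r4, -⟩ := gen_relations hp
  rw [weight_expo, weight_expo]
  simp only [wt]
  omega

theorem degree_f₄ (hp : p.Admissible) (h12 : p.gen 0 < p.gen 1) (h23 : p.gen 1 < p.gen 2)
    (h34 : p.gen 2 < p.gen 3) :
    Finsupp.degree (expo 0 0 0 p.α₄) <
      Finsupp.degree (expo 1 (p.α₂ - 1) (p.α₃ - 1) 0) := by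
  obtain ⟨-, -, -, r4, -⟩ := gen_relations hp
  rw [degree_expo, degree_expo]
  have := Nat.mul_le_mul_left (p.α₂ - 1) (h23.trans h34).le
  have := Nat.mul_le_mul_left (p.α₃ - 1) h34.le
  refine lt_of_mul_lt_mul_right ?_ (Nat.zero_le (p.gen 3))
  simp only [add_mul]
  omega

/-! ### The initial forms -/

theorem initialForm_f₁ (hp : p.Admissible) (h12 : p.gen 0 < p.gen 1) (h23 : p.gen 1 < p.gen 2)
    (h34 : p.gen 2 < p.gen 3) {j : ℕ} (hj : j < p.α₄) :
    initialForm (p.f₁ K j) = -(X 1 ^ (j * p.α₂) * X 2 * X 3 ^ (p.α₄ - (j + 1))) := by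
  rw [f₁_eq, ← neg_sub, initialForm_neg,
    initialForm_binomial_of_lt (degree_f₁ hp h12 h23 h34 hj), monomial_expo]
  ring

theorem initialForm_f₂ (hα : p.α₂₁ + 1 < p.α₂) :
    initialForm (p.f₂ K) = -(X 0 ^ p.α₂₁ * X 3) := by
  rw [f₂_eq, ← neg_sub, initialForm_neg,
    initialForm_binomial_of_lt (by simpa [degree_expo] using hα), monomial_expo]
  ring

theorem initialForm_f₃ (hp : p.Admissible) (h12 : p.gen 0 < p.gen 1) (h23 : p.gen 1 < p.gen 2) :
    initialForm (p.f₃ K) = X 2 ^ p.α₃ := by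
  rw [f₃_eq, initialForm_binomial_of_lt (degree_f₃ hp h12 h23), monomial_expo]
  ring

theorem initialForm_f₄ (hp : p.Admissible) (h12 : p.gen 0 < p.gen 1) (h23 : p.gen 1 < p.gen 2)
    (h34 : p.gen 2 < p.gen 3) : initialForm (p.f₄ K) = X 3 ^ p.α₄ := by
  rw [f₄_eq, initialForm_binomial_of_lt (degree_f₄ hp h12 h23 h34), monomial_expo]
  ring

theorem initialForm_g_of_ne (hp : p.Admissible) (h12 : p.gen 0 < p.gen 1)
    (hα : p.α₂₁ + 1 < p.α₂) {j i : ℕ} (hj : j < p.α₄) (hi : i < p.s j)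
    (hne : p.degLeft j i ≠ p.degRight j i) :
    initialForm (p.g K j i) =
      -(X 0 ^ (i * p.α₁ + ((p.α₄ - 1) * i + j + 1) * p.α₂₁ + 1) * X 2 ^ (p.α₃ - (i + 1))) := by
  have hs := s_le hp h12 hα hj
  have hlt : Finsupp.degree (p.rightExpo j i) < Finsupp.degree (p.leftExpo j i) := by
    have h1 := degree_leftExpo (i := i) hj
    have h2 := degree_rightExpo (j := j) hp (show i < p.α₃ by omega)
    have h3 := degRight_le_degLeft hi
    omega
  rw [g, gLeft_eq, gRight_eq, ← neg_sub, initialForm_neg, initialForm_binomial_of_lt hlt,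
    ← gRight_eq, gRight]

theorem initialForm_g_s (hp : p.Admissible) (h12 : p.gen 0 < p.gen 1)
    (hα : p.α₂₁ + 1 < p.α₂) {j : ℕ} (hj : j < p.α₄) :
    initialForm (p.g K j (p.s j)) =
      X 1 ^ (((p.α₄ - 1) * p.s j + j) * p.α₂ + 1) * X 3 ^ (p.α₄ - (j + 1)) := by
  have hs := s_le hp h12 hα hj
  have h3 := hp.2.2.1
  have hlt : Finsupp.degree (p.leftExpo j (p.s j)) < Finsupp.degree (p.rightExpo j (p.s j)) := by
    have h1 := degree_leftExpo (i := p.s j) hj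
    have h2 := degree_rightExpo (j := j) hp (show p.s j < p.α₃ by omega)
    have h3 := degLeft_lt_degRight_s hp h12 hα hj
    omega
  rw [g, gLeft_eq, gRight_eq, initialForm_binomial_of_lt hlt, ← gLeft_eq, gLeft]

/-- When the degrees agree, `X₂ ^ _` is the leading monomial of `g_{j,i}` for `j = α₄ - 1`. -/
theorem dsLT_right_left (hp : p.Admissible) {j i : ℕ} (hi : i + 1 < p.α₃) (h : p.IsTie j i) :
    dsLT (p.rightExpo j i) (p.leftExpo j i) := by
  obtain ⟨hj, hd⟩ := h
  rw [← degree_leftExpo (show j < p.α₄ by omega), ← degree_rightExpo hp (by omega)] at hd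
  refine Or.inr ⟨by exact_mod_cast hd.symm, 2, fun l hl => ?_, ?_⟩
  · obtain rfl : l = 3 := by omega
    change 0 = p.α₄ - (j + 1)
    omega
  · change 0 < p.α₃ - (i + 1)
    omega

/-- When the degrees agree and j < α₄ - 1, the variable X₄ occurs only in the left monomial and
makes it the smaller one. -/
theorem dsLT_left_right (hp : p.Admissible) {j i : ℕ} (hj : j < p.α₄) (hi : i < p.α₃)
    (hle : p.degRight j i ≤ p.degLeft j i) (h : ¬ p.IsTie j i) :
    dsLT (p.leftExpo j i) (p.rightExpo j i) := by
  rw [IsTie] at h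
  rw [← degree_leftExpo hj, ← degree_rightExpo hp hi] at hle h
  rcases hle.lt_or_eq with hlt | heq
  · exact Or.inl (by exact_mod_cast hlt)
  · refine Or.inr ⟨by exact_mod_cast heq.symm, 3, fun l hl => by omega, ?_⟩
    change 0 < p.α₄ - (j + 1)
    omega

theorem initialForm_g_of_eq (hp : p.Admissible) (h12 : p.gen 0 < p.gen 1)
    (hα : p.α₂₁ + 1 < p.α₂) {j i : ℕ} (hj : j < p.α₄) (hi : i < p.s j)
    (heq : p.degLeft j i = p.degRight j i) : initialForm (p.g K j i) = p.g K j i := by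
  have hs := s_le hp h12 hα hj
  have hd : Finsupp.degree (p.leftExpo j i) = Finsupp.degree (p.rightExpo j i) := by
    have h1 := degree_leftExpo (i := i) hj
    have h2 := degree_rightExpo (j := j) hp (show i < p.α₃ by omega)
    omega
  rw [g, gLeft_eq, gRight_eq]
  by_cases h : p.IsTie j i
  · exact initialForm_binomial_of_eq (dsLT_right_left hp (by omega) h) hd
  · rw [← neg_sub, initialForm_neg,
      initialForm_binomial_of_eq (dsLT_left_right hp hj (by omega) heq.ge h) hd.symm]

/-! ### `G` in the defining ideal, and its rules -/

theorem G_subset_definingIdeal (hp : p.Admissible) (h12 : p.gen 0 < p.gen 1)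
    (hα : p.α₂₁ + 1 < p.α₂) : p.G K ⊆ definingIdeal K p.gen := by
  rintro h ((⟨j, hj, rfl⟩ | rfl | rfl | rfl) | ⟨j, hj, i, -, hi, rfl⟩)
  · rw [f₁_eq]
    exact monomial_sub_mem_definingIdeal _ (weight_f₁ hp hj).symm
  · rw [f₂_eq]
    exact monomial_sub_mem_definingIdeal _ (weight_f₂ hp).symm
  · rw [f₃_eq]
    exact monomial_sub_mem_definingIdeal _ (weight_f₃ hp)
  · rw [f₄_eq]
    exact monomial_sub_mem_definingIdeal _ (weight_f₄ hp)
  · have hs := s_le hp h12 hα hj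
    have h3 := hp.2.2.1
    rw [g, gLeft_eq, gRight_eq]
    exact monomial_sub_mem_definingIdeal _ (weight_leftExpo hp hj (by omega))

theorem finite_G : (p.G K).Finite := by
  refine Set.Finite.union (Set.Finite.union ?_ (Set.toFinite _)) ?_
  · refine ((Finset.range p.α₄).finite_toSet.image (p.f₁ K)).subset ?_
    rintro _ ⟨j, hj, rfl⟩
    exact ⟨j, by simpa using hj, rfl⟩
  · refine ((Finset.range p.α₄).finite_toSet.biUnion fun j _ =>
      (Finset.range (p.s j + 1)).finite_toSet.image (p.g K j)).subset ?_
    rintro _ ⟨j, hj, i, -, hi, rfl⟩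
    exact Set.mem_biUnion (show j ∈ _ by simpa using hj) ⟨i, by simpa [Nat.lt_succ_iff] using hi, rfl⟩

variable {K}

theorem isStd_of_isNormal (hp : p.Admissible) (h12 : p.gen 0 < p.gen 1) (h23 : p.gen 1 < p.gen 2)
    (h34 : p.gen 2 < p.gen 3) (hα : p.α₂₁ + 1 < p.α₂) {a b c d : ℕ}
    (h : IsNormal p.gen (p.G K) (expo a b c d)) : p.IsStd a b c d := by
  have h3 := hp.2.2.1
  have hs : ∀ {j}, j < p.α₄ → p.s j ≤ p.α₃ - 1 := s_le hp h12 hα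
  constructor
  · intro j hj hb hd
    by_contra hc
    refine h _ _ ⟨weight_f₁ hp hj, Or.inl (degree_f₁ hp h12 h23 h34 hj), Or.inr ?_⟩
      (expo_le_expo.2 ⟨Nat.zero_le _, hb, Nat.pos_of_ne_zero hc, hd⟩)
    rw [← f₁_eq]
    exact Or.inl (Or.inl ⟨j, hj, rfl⟩)
  · intro ha
    by_contra hd
    refine h _ _ ⟨weight_f₂ hp, Or.inl (by simpa [degree_expo] using hα), Or.inr ?_⟩
      (expo_le_expo.2 ⟨ha, Nat.zero_le _, Nat.zero_le _, Nat.pos_of_ne_zero hd⟩)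
    rw [← f₂_eq]
    exact Or.inl (Or.inr (Or.inl rfl))
  · by_contra hc
    refine h _ _ ⟨weight_f₃ hp, Or.inl (degree_f₃ hp h12 h23), Or.inl ?_⟩
      (expo_le_expo.2 ⟨Nat.zero_le _, Nat.zero_le _, not_lt.1 hc, Nat.zero_le _⟩)
    rw [← f₃_eq]
    exact Or.inl (Or.inr (Or.inr (Or.inl rfl)))
  · by_contra hd
    refine h _ _ ⟨weight_f₄ hp, Or.inl (degree_f₄ hp h12 h23 h34), Or.inl ?_⟩
      (expo_le_expo.2 ⟨Nat.zero_le _, Nat.zero_le _, Nat.zero_le _, not_lt.1 hd⟩)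
    rw [← f₄_eq]
    exact Or.inl (Or.inr (Or.inr (Or.inr rfl)))
  · intro j hj hb
    by_contra hd
    have hsj := hs hj
    have hlt : Finsupp.degree (p.leftExpo j (p.s j)) < Finsupp.degree (p.rightExpo j (p.s j)) := by
      have h1 := degree_leftExpo (i := p.s j) hj
      have h2 := degree_rightExpo (j := j) hp (show p.s j < p.α₃ by omega)
      have h3 := degLeft_lt_degRight_s hp h12 hα hj
      omega
    refine h (p.leftExpo j (p.s j)) _
      ⟨weight_leftExpo hp hj (by omega), Or.inl hlt, Or.inl ?_⟩
      (expo_le_expo.2 ⟨Nat.zero_le _, hb, Nat.zero_le _, not_lt.1 hd⟩)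
    rw [← gLeft_eq, ← gRight_eq]
    exact Or.inr ⟨j, hj, _, sPrev_le_s hp h12 hα hj, le_rfl, rfl⟩
  · intro j hj i hi hi' htie
    by_contra hb
    have hsj := hs hj
    have hj1 := htie.1
    refine h _ _ ⟨weight_leftExpo hp hj (by omega), dsLT_right_left hp (by omega) htie, Or.inl ?_⟩
      (expo_le_expo.2 ⟨Nat.zero_le _, not_lt.1 hb, Nat.zero_le _, by omega⟩)
    rw [← gLeft_eq, ← gRight_eq]
    exact Or.inr ⟨j, hj, _, hi, hi'.le, rfl⟩
  · intro j hj i hi hi' htie ha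
    by_contra hc
    have hsj := hs hj
    refine h _ _ ⟨(weight_leftExpo hp hj (by omega)).symm,
      dsLT_left_right hp hj (by omega) (degRight_le_degLeft hi') htie, Or.inr ?_⟩
      (expo_le_expo.2 ⟨ha, Nat.zero_le _, not_lt.1 hc, Nat.zero_le _⟩)
    rw [← gLeft_eq, ← gRight_eq]
    exact Or.inr ⟨j, hj, _, hi, hi'.le, rfl⟩

theorem eq_of_isNormal (hp : p.Admissible)
    (hS : IsPseudoSymmetric (AddSubmonoid.closure (Set.range p.gen)))
    (h12 : p.gen 0 < p.gen 1) (h23 : p.gen 1 < p.gen 2)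
    (h34 : p.gen 2 < p.gen 3) (hα : p.α₂₁ + 1 < p.α₂) (x y : Fin 4 →₀ ℕ)
    (hx : IsNormal p.gen (p.G K) x) (hy : IsNormal p.gen (p.G K) y)
    (hw : Finsupp.weight p.gen x = Finsupp.weight p.gen y) : x = y := by
  obtain ⟨a, b, c, d, rfl⟩ := exists_eq_expo x
  obtain ⟨a', b', c', d', rfl⟩ := exists_eq_expo y
  rw [weight_expo, weight_expo] at hw
  obtain ⟨rfl, rfl, rfl, rfl⟩ := (isStd_of_isNormal hp h12 h23 h34 hα hx).eq_of_wt_eq hp hS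
    (fun j hj => s_le hp h12 hα hj) (isStd_of_isNormal hp h12 h23 h34 hα hy) hw
  rfl

theorem gen_ne_zero (h12 : p.gen 0 < p.gen 1) (h23 : p.gen 1 < p.gen 2)
    (h34 : p.gen 2 < p.gen 3) (i : Fin 4) : p.gen i ≠ 0 := by
  have h0 : 0 < p.gen 0 := Nat.succ_pos _
  have h : ∀ i, p.gen i ≠ 0 := by
    rw [Fin.forall_fin_succ, Fin.forall_fin_succ, Fin.forall_fin_succ, Fin.forall_fin_one]
    exact ⟨h0.ne', (h0.trans h12).ne', (h0.trans (h12.trans h23)).ne',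
      (h0.trans (h12.trans (h23.trans h34))).ne'⟩
  exact h i

end Params

/-! ### A criterion for a ring not to be Cohen–Macaulay -/

/-- A localization of positive dimension and depth zero. -/
theorem not_isCohenMacaulayLocalRing_of_torsion {R : Type*} [CommRing R] {P Q : Ideal R}
    [P.IsPrime] [Q.IsPrime] (hPQ : P < Q) (y : R) (hy : ∀ u, u ∉ Q → u * y ≠ 0)
    (htors : ∀ r ∈ Q, ∃ N : ℕ, r ^ N * y = 0) :
    ¬ IsCohenMacaulayLocalRing (Localization.AtPrime Q) := by
  rintro ⟨rs, hmem, hreg, hdim⟩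
  cases rs with
  -- An empty regular sequence means dimension zero, so `Q` would be a minimal prime, against P < Q.
  | nil =>
    rw [IsLocalization.AtPrime.ringKrullDim_eq_height Q] at hdim
    have h0 : Q.height = 0 := by
      have := WithBot.coe_injective hdim
      simpa using this.symm
    rw [Ideal.height_eq_zero_iff] at h0
    exact hPQ.not_ge (h0.2 ⟨inferInstance, bot_le⟩ hPQ.le)
  | cons r rs =>
    have hr := ((RingTheory.Sequence.isRegular_cons_iff _ _ _).1 hreg).1
    have hrm := hmem r List.mem_cons_self
    obtain ⟨a, s, rfl⟩ := IsLocalization.exists_mk'_eq Q.primeCompl r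
    rw [IsLocalization.AtPrime.mk'_mem_maximal_iff _ Q] at hrm
    obtain ⟨N, hN⟩ := htors a hrm
    -- A power of the first regular element kills `y`; powers of a regular element are regular, so
    -- `y` would vanish in the localization.
    have hz : (IsLocalization.mk' (Localization.AtPrime Q) a s) ^ N •
        algebraMap R (Localization.AtPrime Q) y = 0 := by
      rw [← IsLocalization.mk'_pow, smul_eq_mul, mul_comm, IsLocalization.mul_mk'_eq_mk'_of_mul,
        mul_comm, hN, IsLocalization.mk'_zero]
    have hy0 := (hr.pow N).right_eq_zero_of_smul hz
    rw [IsLocalization.map_eq_zero_iff Q.primeCompl] at hy0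
    obtain ⟨u, hu⟩ := hy0
    exact hy u u.2 hu

/-- The quotient of a polynomial ring by an ideal contained in the ideal of the first coordinate
axis is not Cohen–Macaulay if it contains an element which is killed by powers of all variables but
is nonzero near the origin. -/
theorem not_isCohenMacaulayRing_quotient {K : Type*} [Field K] {k : ℕ}
    {J : Ideal (MvPolynomial (Fin (k + 1)) K)}
    (hJ : ∀ f ∈ J, aeval (Pi.single 0 Polynomial.X : Fin (k + 1) → Polynomial K) f = 0)
    (x : MvPolynomial (Fin (k + 1)) K) (hx : ∀ f, constantCoeff f ≠ 0 → f * x ∉ J)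
    (htors : ∀ i, ∃ N : ℕ, X i ^ N * x ∈ J) :
    ¬ IsCohenMacaulayRing (MvPolynomial (Fin (k + 1)) K ⧸ J) := by
  intro hCM
  let φ : MvPolynomial (Fin (k + 1)) K →+* Polynomial K :=
    (aeval (R := K) (Pi.single 0 Polynomial.X : Fin (k + 1) → Polynomial K)).toRingHom
  have hφ : ∀ f, (φ f).coeff 0 = constantCoeff f := by
    intro f
    have : (Polynomial.constantCoeff.comp φ : MvPolynomial (Fin (k + 1)) K →+* K) =
        constantCoeff := by
      ext i
      · simp [φ]
      · rcases eq_or_ne i 0 with rfl | hi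
        · simp [φ]
        · simp [φ, hi]
    exact DFunLike.congr_fun this f
  let ψ := Ideal.Quotient.lift J φ hJ
  -- `P` is the prime of the first coordinate axis, `Q` the maximal ideal of the origin.
  let P : Ideal (MvPolynomial (Fin (k + 1)) K ⧸ J) := RingHom.ker ψ
  let Q : Ideal (MvPolynomial (Fin (k + 1)) K ⧸ J) :=
    RingHom.ker (Polynomial.constantCoeff.comp ψ)
  have hP : P.IsPrime := RingHom.ker_isPrime _
  have hQ : Q.IsPrime := RingHom.ker_isPrime _
  have hmemQ : ∀ f, Ideal.Quotient.mk J f ∈ Q ↔ constantCoeff f = 0 := by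
    intro f
    rw [← hφ f]
    rfl
  refine not_isCohenMacaulayLocalRing_of_torsion (P := P) (Q := Q) ?_ (Ideal.Quotient.mk J x)
    ?_ ?_ (hCM Q)
  · refine lt_of_le_of_ne (fun z hz => ?_) fun h => ?_
    · rw [RingHom.mem_ker] at hz ⊢
      rw [RingHom.comp_apply, hz, map_zero]
    · have h1 : Ideal.Quotient.mk J (X 0) ∈ Q := (hmemQ _).2 (by simp)
      rw [← h, RingHom.mem_ker] at h1
      have h2 : φ (X 0) = 0 := h1
      simp [φ] at h2
  · intro u hu h
    obtain ⟨f, rfl⟩ := Ideal.Quotient.mk_surjective u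
    rw [hmemQ] at hu
    rw [← map_mul, Ideal.Quotient.eq_zero_iff_mem] at h
    exact hx f hu h
  · intro u hu
    obtain ⟨f, rfl⟩ := Ideal.Quotient.mk_surjective u
    rw [hmemQ] at hu
    have hf : f ∈ Ideal.span (X '' (Set.univ : Set (Fin (k + 1)))) := by
      rw [mem_ideal_span_X_image]
      intro m hm
      by_contra hcon
      push Not at hcon
      have : m = 0 := by
        ext i
        exact hcon i (Set.mem_univ i)
      rw [mem_support_iff, this] at hm
      exact hm hu
    have hle : Ideal.span (X '' (Set.univ : Set (Fin (k + 1)))) ≤ (J.colon {x}).radical := by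
      rw [Ideal.span_le]
      rintro _ ⟨i, -, rfl⟩
      obtain ⟨N, hN⟩ := htors i
      exact ⟨N, Submodule.mem_colon_singleton.2 hN⟩
    obtain ⟨N, hN⟩ := hle hf
    refine ⟨N, ?_⟩
    rw [← map_pow, ← map_mul, Ideal.Quotient.eq_zero_iff_mem]
    exact Submodule.mem_colon_singleton.1 hN

/-! ### The tangent cone is not Cohen–Macaulay -/

namespace Params

variable {p : Params} {K : Type*} [Field K]

/-- X₄ is the only monomial of weight n₄, so the coefficient sum at (n₄, 1) vanishes on the ideal of
initial forms; on f X₄ it equals the constant term of f. -/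
theorem mul_X_three_notMem (hp : p.Admissible)
    (hS : IsPseudoSymmetric (AddSubmonoid.closure (Set.range p.gen)))
    (f : MvPolynomial (Fin 4) K) (hf : constantCoeff f ≠ 0) :
    f * X 3 ∉ initialIdeal (definingIdeal K p.gen) := by
  intro h
  have h0 := initialIdeal_le_gradedKernel p.gen h (p.gen 3) 1 ?_
  · have hX : (X 3 : MvPolynomial (Fin 4) K) = monomial (expo 0 0 0 1) 1 := by
      rw [monomial_expo]; simp
    have hw : Finsupp.weight p.gen (expo 0 0 0 1) = p.gen 3 := by
      rw [weight_expo]; simp [wt]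
    have hd : Finsupp.degree (expo 0 0 0 1) = 1 := degree_expo 0 0 0 1
    rw [mul_comm, hX, coeffSum_monomial_mul, hw, hd, if_pos ⟨le_rfl, le_rfl⟩, one_mul,
      coeffSum_eq_sum, Finset.sum_eq_single 0] at h0
    · exact hf (by simpa [constantCoeff_eq] using h0)
    · intro b _ hb
      refine if_neg fun h => hb ?_
      simpa [Finsupp.degree_eq_zero_iff] using h.2
    · intro h
      rw [notMem_support_iff.1 h, ite_self]
  · intro c hc
    obtain ⟨a, b, c, d, rfl⟩ := exists_eq_expo c
    rw [weight_expo] at hc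
    obtain ⟨rfl, rfl, rfl, rfl⟩ := eq_of_wt_eq_gen_three hp hS hc
    rw [degree_expo]

theorem not_isCohenMacaulayRing (hp : p.Admissible)
    (hS : IsPseudoSymmetric (AddSubmonoid.closure (Set.range p.gen)))
    (h12 : p.gen 0 < p.gen 1) (h23 : p.gen 1 < p.gen 2) (h34 : p.gen 2 < p.gen 3)
    (hα : p.α₂₁ + 1 < p.α₂) :
    ¬ IsCohenMacaulayRing (MvPolynomial (Fin 4) K ⧸ initialIdeal (definingIdeal K p.gen)) := by
  have hspan := span_initialForm_eq (gen_ne_zero h12 h23 h34)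
    (eq_of_isNormal (K := K) hp hS h12 h23 h34 hα) (G_subset_definingIdeal K hp h12 hα)
  have hmem : ∀ f ∈ p.G K, initialForm f ∈ initialIdeal (definingIdeal K p.gen) := fun f hf =>
    hspan ▸ Ideal.subset_span ⟨f, hf, rfl⟩
  obtain ⟨-, h2, h3, h4, h5, -⟩ := id hp
  refine not_isCohenMacaulayRing_quotient ?_ (X 3)
    (mul_X_three_notMem hp hS) ?_
  · suffices h : initialIdeal (definingIdeal K p.gen) ≤
        RingHom.ker (aeval (Pi.single 0 Polynomial.X : Fin 4 → Polynomial K)) from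
      fun f hf => h hf
    rw [← hspan, Ideal.span_le]
    rintro _ ⟨f, (⟨j, hj, rfl⟩ | rfl | rfl | rfl) | ⟨j, hj, i, -, hi, rfl⟩, rfl⟩ <;>
      rw [SetLike.mem_coe, RingHom.mem_ker]
    · rw [initialForm_f₁ K hp h12 h23 h34 hj]
      simp
    · rw [initialForm_f₂ K hα]
      simp
    · rw [initialForm_f₃ K hp h12 h23]
      simp; omega
    · rw [initialForm_f₄ K hp h12 h23 h34]
      simp; omega
    · have hs := s_le hp h12 hα hj
      rcases hi.eq_or_lt with rfl | hi
      · rw [initialForm_g_s K hp h12 hα hj]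
        simp
      -- Since i < s_j ≤ α₃ - 1, a positive power of X₃ remains and vanishes on the X₁-axis.
      · have h0 : p.α₃ - (i + 1) ≠ 0 := by omega
        by_cases heq : p.degLeft j i = p.degRight j i
        · rw [initialForm_g_of_eq K hp h12 hα hj hi heq, g, gLeft, gRight]
          simp [h0]
        · rw [initialForm_g_of_ne K hp h12 hα hj hi heq]
          simp [h0]
  · rw [Fin.forall_fin_succ, Fin.forall_fin_succ, Fin.forall_fin_succ, Fin.forall_fin_one]
    -- The killing powers come from the initial forms of f₂, of g_{j,s_j} with j = α₄ - 2 (where X₄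
    -- has exponent 1), of f₃ and of f₄.
    refine ⟨⟨p.α₂₁, ?_⟩, ⟨((p.α₄ - 1) * p.s (p.α₄ - 2) + (p.α₄ - 2)) * p.α₂ + 1, ?_⟩,
      ⟨p.α₃, ?_⟩, ⟨p.α₄, ?_⟩⟩
    · have := hmem (p.f₂ K) (Or.inl (Or.inr (Or.inl rfl)))
      rwa [initialForm_f₂ K hα, neg_mem_iff] at this
    · have hj : p.α₄ - 2 < p.α₄ := by omega
      have := hmem (p.g K (p.α₄ - 2) (p.s (p.α₄ - 2)))
        (Or.inr ⟨_, hj, _, sPrev_le_s hp h12 hα hj, le_rfl, rfl⟩)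
      rwa [initialForm_g_s K hp h12 hα hj, show p.α₄ - (p.α₄ - 2 + 1) = 1 by omega,
        pow_one] at this
    · have := hmem (p.f₃ K) (Or.inl (Or.inr (Or.inr (Or.inl rfl))))
      rw [initialForm_f₃ K hp h12 h23] at this
      exact Ideal.mul_mem_right _ _ this
    · have := hmem (p.f₄ K) (Or.inl (Or.inr (Or.inr (Or.inr rfl))))
      rw [initialForm_f₄ K hp h12 h23 h34] at this
      exact Ideal.mul_mem_right _ _ this

end Params

end PseudoSym

end

theorem mainTheorem3 {K : Type*} [Field K] (p : PseudoSym.Params) (hp : p.Admissible)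
    (hgcd : Finset.univ.gcd p.gen = 1)
    (hS : PseudoSym.IsPseudoSymmetric (AddSubmonoid.closure (Set.range p.gen)))
    (h12 : p.gen 0 < p.gen 1) (h23 : p.gen 1 < p.gen 2) (h34 : p.gen 2 < p.gen 3)
    (hα : p.α₂₁ + 1 < p.α₂) :
    -- the explicit initial forms, with their signs
    (∀ j < p.α₄, PseudoSym.initialForm (p.f₁ K j) =
      -(X 1 ^ (j * p.α₂) * X 2 * X 3 ^ (p.α₄ - (j + 1)))) ∧
    PseudoSym.initialForm (p.f₂ K) = -(X 0 ^ p.α₂₁ * X 3) ∧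
    PseudoSym.initialForm (p.f₃ K) = X 2 ^ p.α₃ ∧
    PseudoSym.initialForm (p.f₄ K) = X 3 ^ p.α₄ ∧
    (∀ j < p.α₄, ∀ i, p.sPrev j ≤ i → i < p.s j → p.degLeft j i ≠ p.degRight j i →
      PseudoSym.initialForm (p.g K j i) =
        -(X 0 ^ (i * p.α₁ + ((p.α₄ - 1) * i + j + 1) * p.α₂₁ + 1) * X 2 ^ (p.α₃ - (i + 1)))) ∧
    (∀ j < p.α₄, ∀ i, p.sPrev j ≤ i → i < p.s j → p.degLeft j i = p.degRight j i →
      PseudoSym.initialForm (p.g K j i) = p.g K j i) ∧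
    (∀ j < p.α₄, PseudoSym.initialForm (p.g K j (p.s j)) =
      X 1 ^ (((p.α₄ - 1) * p.s j + j) * p.α₂ + 1) * X 3 ^ (p.α₄ - (j + 1))) ∧
    -- they generate the ideal of initial forms
    Ideal.span (PseudoSym.initialForm '' p.G K) =
      PseudoSym.initialIdeal (PseudoSym.definingIdeal K p.gen) ∧
    -- and they form a standard basis of it
    PseudoSym.IsStandardBasis (PseudoSym.initialForm '' p.G K)
      (PseudoSym.initialIdeal (PseudoSym.definingIdeal K p.gen)) ∧
    -- the tangent cone is not Cohen–Macaulay
    (X 0 : MvPolynomial (Fin 4) K) ∣ PseudoSym.initialForm (p.f₂ K) ∧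
    ¬ PseudoSym.IsCohenMacaulayRing (MvPolynomial (Fin 4) K ⧸
      PseudoSym.initialIdeal (PseudoSym.definingIdeal K p.gen)) := by
  have hn := PseudoSym.Params.gen_ne_zero h12 h23 h34
  have huniq := PseudoSym.Params.eq_of_isNormal (K := K) hp hS h12 h23 h34 hα
  have hG := PseudoSym.Params.G_subset_definingIdeal K hp h12 hα
  refine ⟨fun j hj => PseudoSym.Params.initialForm_f₁ K hp h12 h23 h34 hj,
    PseudoSym.Params.initialForm_f₂ K hα, PseudoSym.Params.initialForm_f₃ K hp h12 h23,
    PseudoSym.Params.initialForm_f₄ K hp h12 h23 h34,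
    fun j hj i _ hi hne => PseudoSym.Params.initialForm_g_of_ne K hp h12 hα hj hi hne,
    fun j hj i _ hi heq => PseudoSym.Params.initialForm_g_of_eq K hp h12 hα hj hi heq,
    fun j hj => PseudoSym.Params.initialForm_g_s K hp h12 hα hj,
    PseudoSym.span_initialForm_eq hn huniq hG,
    PseudoSym.isStandardBasis_initialForm hn huniq hG (PseudoSym.Params.finite_G K), ?_,
    PseudoSym.Params.not_isCohenMacaulayRing hp hS h12 h23 h34 hα⟩
  rw [PseudoSym.Params.initialForm_f₂ K hα]
  exact ((dvd_pow_self _ hp.2.2.2.2.1.ne').mul_right _).neg_right
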